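/- Let $K$ be a continuous symmetric positive-definite (i.e. positive semidefinite) kernel on $\mathbb{R}^p$, with reproducing kernel Hilbert space $\mathcal{H}(K)$, inner product $\langle\cdot,\cdot\rangle$ and norm $\|\cdot\|$. Let $(Y_i)_{i\in\mathbb{Z}}$ be $\mathbb{R}^p$-valued random vectors on a probability space which satisfy the null hypothesis of no change in the marginal distribution, i.e. all $Y_i$ have the same law $P$ (for instance, $(Y_i)$ is strictly stationary), and let $P$ have a mean embedding $\mu_P\in\mathcal{H}(K)$, i.e. $\langle f,\mu_P\rangle=\mathbb{E}f(Y_0)$ (with finite expectation) for all $f\in\mathcal{H}(K)$. **Assumption 1.** As $n\to\infty$, $$\Bigl(\tfrac1{\sqrt n}\sum_{i=1}^{\lfloor nt\rfloor}\bigl(K(Y_i,\cdot)-\mu_P\bigr)\Bigr)_{t\in[0,1]}\leadsto (W(t))_{t\in[0,1]}$$ weakly in the space $D_{\mathcal{H}(K)}[0,1]$ of cadlag functions with the Skorokhod metric $\rho(f,g)=\inf_\lambda\{\sup_t\|f(t)-g(\lambda(t))\|+\sup_t|t-\lambda(t)|\}$, where $\lambda$ ranges over the increasing homeomorphisms of $[0,1]$.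 Here $W$ is a Brownian motion in $\mathcal{H}(K)$: $W(0)=0$ a.s., the paths are a.s. continuous, the increments over disjoint intervals are independent, and for $s\le t$ the increment $W(t)-W(s)$ is Gaussian with mean zero and covariance operator $(t-s)S$. The operator $S$ is given by $$\langle Sx,y\rangle=\sum_{i\in\mathbb{Z}}\mathbb{E}\bigl[\langle K(Y_0,\cdot)-\mu_P,x\rangle\langle K(Y_i,\cdot)-\mu_P,y\rangle\bigr],\qquad x,y\in\mathcal{H}(K),$$ where all the expectations are finite and the series converges absolutely. Moreover $S\neq0$. **Statistic.** Fix $\eta\in(0,1/2)$ and put $m_1=\lfloor n\eta\rfloor$, $N=n-2m_1$, $$Z_k=\Bigl\langle \tfrac1{m_1}\sum_{i=1}^{m_1}K(Y_i,\cdot)-\tfrac1{m_1}\sum_{j=n-m_1+1}^{n}K(Y_j,\cdot),\;K(Y_{m_1+k},\cdot)\Bigr\rangle,\quad 1\le k\le N,\qquad Z_{i:j}=\sum_{k=i}^jZ_k,$$ $$T_n(k)=N^{-1/2}\sum_{t=1}^k\Bigl(Z_t-\tfrac1NZ_{1:N}\Bigr),$$ $$V_n(k)=N^{-2}\Bigl(\sum_{t=1}^k\bigl(Z_{1:t}-\tfrac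 tkZ_{1:k}\bigr)^2+\sum_{t=k+1}^N\bigl(Z_{t:N}-\tfrac{N-t+1}{N-k}Z_{k+1:N}\bigr)^2\Bigr),$$ $$G_n=\sup_{1\le k\le N-1}T_n(k)/V_n(k)^{1/2}.$$ (Quotients with denominator zero are set to $0$, and so is the supremum over an empty set of $k$.) **Theorem.** Under Assumption 1 and the null hypothesis, $G_n$ converges in distribution as $n\to\infty$ to $$G=\sup_{r\in[0,1]}\frac{B(r)-rB(1)}{\Bigl(\int_0^r\bigl(B(s)-\frac srB(r)\bigr)^2ds+\int_r^1\bigl(B(1)-B(s)-\frac{1-s}{1-r}(B(1)-B(r))\bigr)^2ds\Bigr)^{1/2}},$$ where $B$ is a standard Brownian motion. -/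

import Mathlib

open MeasureTheory ProbabilityTheory Filter Set
open scoped Topology NNReal ENNReal RealInnerProductSpace

namespace KernelCPD

/-! ### Cadlag paths and the Skorokhod topology -/

/-- Cadlag functions `[0,1] → H`: right continuous with left limits at every point. -/
@[ext]
structure CadlagPath (H : Type*) [TopologicalSpace H] where
  toFun : unitInterval → H
  rightCont : ∀ t, ContinuousWithinAt toFun (Ici t) t
  leftLim : ∀ t, ∃ l, Tendsto toFun (𝓝[<] t) (𝓝 l)

namespace CadlagPath

instance {H : Type*} [TopologicalSpace H] :
    CoeFun (CadlagPath H) (fun _ => unitInterval → H) := ⟨toFun⟩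

/-- The Skorokhod distance
`ρ(f, g) = inf_λ (sup_t ‖f t - g (λ t)‖ + sup_t |t - λ t|)`, where `λ` runs over the strictly
increasing continuous maps of `[0,1]` onto itself, that is, over the order automorphisms of
`[0,1]`. It is written with values in `[0,∞]`, so that suprema and infima have no junk values. -/
noncomputable def skorokhodDist {H : Type*} [PseudoEMetricSpace H] (f g : CadlagPath H) : ℝ≥0∞ :=
  ⨅ lam : unitInterval ≃o unitInterval,
    (⨆ t, edist (f t) (g (lam t))) + ⨆ t, edist t (lam t)

/-- The space `D_H[0,1]` with the Skorokhod distance. -/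
noncomputable instance {H : Type*} [PseudoEMetricSpace H] : PseudoEMetricSpace (CadlagPath H) where
  edist := skorokhodDist
  edist_self f := by
    refine le_antisymm ((iInf_le _ (OrderIso.refl _)).trans ?_) zero_le
    simp
  edist_comm := by
    have key : ∀ f g : CadlagPath H, skorokhodDist f g ≤ skorokhodDist g f := by
      intro f g
      refine le_iInf fun lam => (iInf_le _ lam.symm).trans ?_
      refine add_le_add (iSup_le fun t => ?_) (iSup_le fun t => ?_)
      · refine le_trans ?_ (le_iSup _ (lam.symm t))
        simp [edist_comm]
      · refine le_trans ?_ (le_iSup _ (lam.symm t))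
        simp [edist_comm]
    exact fun f g => le_antisymm (key f g) (key g f)
  edist_triangle f g h := by
    refine ENNReal.le_iInf_add_iInf fun l₁ l₂ => (iInf_le _ (l₁.trans l₂)).trans ?_
    rw [add_add_add_comm]
    refine add_le_add (iSup_le fun t => ?_) (iSup_le fun t => ?_)
    · exact (edist_triangle _ (g (l₁ t)) _).trans
        (add_le_add (le_iSup (fun t => edist (f t) (g (l₁ t))) t)
          (le_iSup (fun t => edist (g t) (h (l₂ t))) (l₁ t)))
    · exact (edist_triangle _ (l₁ t) _).trans
        (add_le_add (le_iSup (fun t => edist t (l₁ t)) t)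
          (le_iSup (fun t => edist t (l₂ t)) (l₁ t)))

/-- `D_H[0,1]` carries the Borel σ-algebra of the Skorokhod topology. -/
noncomputable instance {H : Type*} [PseudoEMetricSpace H] : MeasurableSpace (CadlagPath H) := borel _

instance {H : Type*} [PseudoEMetricSpace H] : BorelSpace (CadlagPath H) := ⟨rfl⟩

/-- The path `t ↦ a ⌊n t⌋` on `[0,1]`, which is a cadlag step function. -/
noncomputable def ofStep {H : Type*} [TopologicalSpace H] (n : ℕ) (a : ℕ → H) : CadlagPath H where
  toFun t := a ⌊(n : ℝ) * (t : ℝ)⌋₊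
  rightCont t := by
    have hc : Continuous fun s : unitInterval => (n : ℝ) * (s : ℝ) := by fun_prop
    have h1 : ∀ᶠ s : unitInterval in 𝓝 t, (n : ℝ) * (s : ℝ) < ⌊(n : ℝ) * (t : ℝ)⌋₊ + 1 :=
      hc.continuousAt.eventually_lt continuousAt_const (Nat.lt_floor_add_one _)
    refine tendsto_nhds_of_eventually_eq ?_
    filter_upwards [nhdsWithin_le_nhds h1, self_mem_nhdsWithin] with s hs hts
    have hts' : (t : ℝ) ≤ s := hts
    congr 1
    refine le_antisymm ?_ (Nat.floor_le_floor (by gcongr))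
    have h0 : (0 : ℝ) ≤ (n : ℝ) * (s : ℝ) := mul_nonneg (Nat.cast_nonneg n) s.2.1
    have : ⌊(n : ℝ) * (s : ℝ)⌋₊ < ⌊(n : ℝ) * (t : ℝ)⌋₊ + 1 :=
      (Nat.floor_lt h0).2 (by push_cast; exact hs)
    omega
  leftLim t := by
    refine ⟨a (⌈(n : ℝ) * (t : ℝ)⌉₊ - 1), tendsto_nhds_of_eventually_eq ?_⟩
    have hc : Continuous fun s : unitInterval => (n : ℝ) * (s : ℝ) := by fun_prop
    rcases Nat.eq_zero_or_pos ⌈(n : ℝ) * (t : ℝ)⌉₊ with h0 | h0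
    · filter_upwards [self_mem_nhdsWithin] with s hs
      have hst : (s : ℝ) < t := hs
      have h1 : (n : ℝ) * (t : ℝ) ≤ 0 := Nat.ceil_eq_zero.1 h0
      have h2 : (n : ℝ) * (s : ℝ) ≤ (n : ℝ) * (t : ℝ) := by gcongr
      rw [h0, Nat.floor_of_nonpos (h2.trans h1)]
    · have h1 : ((⌈(n : ℝ) * (t : ℝ)⌉₊ - 1 : ℕ) : ℝ) < (n : ℝ) * (t : ℝ) :=
        Nat.lt_ceil.1 (by omega)
      have h2 : ∀ᶠ s : unitInterval in 𝓝 t,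
          ((⌈(n : ℝ) * (t : ℝ)⌉₊ - 1 : ℕ) : ℝ) < (n : ℝ) * (s : ℝ) :=
        continuousAt_const.eventually_lt hc.continuousAt h1
      have hn : (0 : ℝ) < n := by
        rcases Nat.eq_zero_or_pos n with rfl | h
        · simp at h0
        · exact_mod_cast h
      filter_upwards [nhdsWithin_le_nhds h2, self_mem_nhdsWithin] with s hs hst
      have hst' : (s : ℝ) < t := hst
      congr 1
      have hs0 : (0 : ℝ) ≤ (n : ℝ) * (s : ℝ) := mul_nonneg (Nat.cast_nonneg n) s.2.1
      refine (Nat.floor_eq_iff hs0).2 ⟨hs.le, ?_⟩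
      have h3 : (n : ℝ) * (s : ℝ) < (n : ℝ) * (t : ℝ) := by gcongr
      have h4 : (n : ℝ) * (t : ℝ) ≤ ⌈(n : ℝ) * (t : ℝ)⌉₊ := Nat.le_ceil _
      have h5 : ((⌈(n : ℝ) * (t : ℝ)⌉₊ - 1 : ℕ) : ℝ) + 1 = ⌈(n : ℝ) * (t : ℝ)⌉₊ := by
        exact_mod_cast Nat.sub_add_cancel h0
      linarith

end CadlagPath

/-! ### The reproducing kernel Hilbert space -/

section RKHSDefs

variable {E : Type*} (H : Type*) [NormedAddCommGroup H] [InnerProductSpace ℝ H] [CompleteSpace H]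
  [RKHS ℝ H E ℝ]

/-- The element `K(x, ·)` of the real-valued reproducing kernel Hilbert space `H`. -/
noncomputable def feature (x : E) : H := RKHS.kerFun H x 1

/-- `H` is the reproducing kernel Hilbert space `ℋ(K)` of `K : E × E → ℝ`: it is a Hilbert space of
functions on `E` with reproducing kernel `K`. (Such a `K` is automatically symmetric and positive
semidefinite, and every symmetric positive semidefinite `K` has exactly one such space of
functions.) -/
def HasReproducingKernel (K : E → E → ℝ) : Prop :=
  ∀ x y, feature H x y = K x y

variable {H}

/-- `m ∈ ℋ(K)` is the mean embedding of `P`: `⟨f, m⟩ = 𝔼_{X ∼ P} f(X)` for all `f ∈ ℋ(K)`, all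
these expectations being finite. -/
def IsMeanEmbedding [MeasurableSpace E] (P : Measure E) (m : H) : Prop :=
  ∀ f : H, Integrable (fun x => f x) P ∧ ⟪f, m⟫ = ∫ x, f x ∂P

/-- The normalised partial sum path `t ↦ n^{-1/2} ∑_{i=1}^{⌊nt⌋} (K(y_i, ·) - m)`. -/
noncomputable def partialSumPath (m : H) (n : ℕ) (y : ℤ → E) : CadlagPath H :=
  CadlagPath.ofStep n fun j => (√(n : ℝ))⁻¹ • ∑ i ∈ Finset.Icc 1 j, (feature H (y (i : ℤ)) - m)

end RKHSDefs

/-! ### Brownian motion in a Hilbert space and the functional central limit theorem -/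

/-- The random element `W` of `D_H[0,1]` is a Brownian motion in `H` whose value at time `1` has
covariance operator `S`. -/
structure IsHilbertBrownianMotion {Ω H : Type*} [MeasurableSpace Ω] [NormedAddCommGroup H]
    [InnerProductSpace ℝ H] [MeasurableSpace H]
    (W : Ω → CadlagPath H) (S : H →L[ℝ] H) (ν : Measure Ω) : Prop where
  aemeasurable : AEMeasurable W ν
  start_zero : ∀ᵐ ω ∂ν, W ω 0 = 0
  continuous_paths : ∀ᵐ ω ∂ν, Continuous (W ω).toFun
  indep_increments : HasIndepIncrements (fun (t : unitInterval) ω => W ω t) ν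
  gaussian_increments : ∀ s t : unitInterval, s ≤ t → HasGaussianLaw (fun ω => W ω t - W ω s) ν
  mean_increments : ∀ s t : unitInterval, s ≤ t → ∀ h : H, ∫ ω, ⟪W ω t - W ω s, h⟫ ∂ν = 0
  covariance_increments : ∀ s t : unitInterval, s ≤ t → ∀ h₁ h₂ : H,
    ∫ ω, ⟪W ω t - W ω s, h₁⟫ * ⟪W ω t - W ω s, h₂⟫ ∂ν = ((t : ℝ) - (s : ℝ)) * ⟪S h₁, h₂⟫

/-- The functional central limit theorem in `ℋ(K)`: the normalised partial sums of
`K(Y_i, ·) - m` converge weakly in `D_{ℋ(K)}[0,1]` to a Brownian motion `W`, and the covariance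
operator `S` of `W(1)` is the long-run covariance operator
`⟨S x, y⟩ = ∑_{i ∈ ℤ} 𝔼[⟨K(Y_0, ·) - m, x⟩ ⟨K(Y_i, ·) - m, y⟩]`, the series being absolutely
convergent (for real series over `ℤ`, `HasSum` means absolute convergence). -/
structure SatisfiesFCLT {E H Ω Ω' : Type*} [MeasurableSpace Ω] [MeasurableSpace Ω']
    [NormedAddCommGroup H] [InnerProductSpace ℝ H] [CompleteSpace H] [MeasurableSpace H]
    [RKHS ℝ H E ℝ] (Y : ℤ → Ω → E) (m : H) (W : Ω' → CadlagPath H) (S : H →L[ℝ] H)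
    (μ : Measure Ω) [IsProbabilityMeasure μ] (ν : Measure Ω') [IsProbabilityMeasure ν] :
    Prop where
  weak_convergence : TendstoInDistribution
    (fun (n : ℕ) ω => partialSumPath m n (fun i => Y i ω)) atTop W (fun _ => μ) ν
  brownian : IsHilbertBrownianMotion W S ν
  integrable : ∀ (i : ℤ) (x y : H),
    Integrable (fun ω => ⟪feature H (Y 0 ω) - m, x⟫ * ⟪feature H (Y i ω) - m, y⟫) μ
  covariance_hasSum : ∀ x y : H,
    HasSum (fun i : ℤ => ∫ ω, ⟪feature H (Y 0 ω) - m, x⟫ * ⟪feature H (Y i ω) - m, y⟫ ∂μ) ⟪S x, y⟫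

/-! ### The test statistic -/

section Statistic

variable {E : Type*} (H : Type*) [NormedAddCommGroup H] [InnerProductSpace ℝ H] [CompleteSpace H]
  [RKHS ℝ H E ℝ]

/-- `m₁ = ⌊n η⌋`, the size of the first and of the third subsample. -/
noncomputable def splitSize (η : ℝ) (n : ℕ) : ℕ := ⌊(n : ℝ) * η⌋₊

/-- `N = n - 2 m₁`, the size of the middle subsample; `2 m₁ ≤ n` when `η < 1/2`. -/
noncomputable def midSize (η : ℝ) (n : ℕ) : ℕ := n - 2 * splitSize η n

/-- The projection direction
`μ̂₁ - μ̂ₙ = m₁⁻¹ ∑_{i=1}^{m₁} K(y_i, ·) - m₁⁻¹ ∑_{j=n-m₁+1}^{n} K(y_j, ·)`. -/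
noncomputable def direction (η : ℝ) (n : ℕ) (y : ℕ → E) : H :=
  (splitSize η n : ℝ)⁻¹ • ∑ i ∈ Finset.Icc 1 (splitSize η n), feature H (y i)
    - (splitSize η n : ℝ)⁻¹ • ∑ j ∈ Finset.Icc (n - splitSize η n + 1) n, feature H (y j)

/-- The projected middle subsample `Z_k = ⟨μ̂₁ - μ̂ₙ, K(y_{m₁+k}, ·)⟩`. -/
noncomputable def projected (η : ℝ) (n : ℕ) (y : ℕ → E) (k : ℕ) : ℝ :=
  ⟪direction H η n y, feature H (y (splitSize η n + k))⟫

/-- The CUSUM `N^{-1/2} ∑_{t=1}^k (z_t - N⁻¹ ∑_{j=1}^N z_j)` of `z_1, …, z_N`. -/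
noncomputable def cusum (N : ℕ) (z : ℕ → ℝ) (k : ℕ) : ℝ :=
  (√(N : ℝ))⁻¹ * ∑ t ∈ Finset.Icc 1 k, (z t - (N : ℝ)⁻¹ * ∑ j ∈ Finset.Icc 1 N, z j)

/-- The self-normalizer
`N⁻² (∑_{t=1}^k (z_{1:t} - (t/k) z_{1:k})² + ∑_{t=k+1}^N (z_{t:N} - ((N-t+1)/(N-k)) z_{k+1:N})²)`,
where `z_{i:j} = z_i + ⋯ + z_j`. -/
noncomputable def selfNormalizer (N : ℕ) (z : ℕ → ℝ) (k : ℕ) : ℝ :=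
  ((N : ℝ) ^ 2)⁻¹ *
    (∑ t ∈ Finset.Icc 1 k,
        (∑ j ∈ Finset.Icc 1 t, z j - (t : ℝ) / k * ∑ j ∈ Finset.Icc 1 k, z j) ^ 2
      + ∑ t ∈ Finset.Icc (k + 1) N,
        (∑ j ∈ Finset.Icc t N, z j
          - ((N : ℝ) - t + 1) / ((N : ℝ) - k) * ∑ j ∈ Finset.Icc (k + 1) N, z j) ^ 2)

/-- The statistic `G_n = sup_{1 ≤ k ≤ N-1} T_n(k) / V_n(k)^{1/2}`. -/
noncomputable def testStatistic (η : ℝ) (n : ℕ) (y : ℕ → E) : ℝ :=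
  ⨆ k : Icc 1 (midSize η n - 1),
    cusum (midSize η n) (projected H η n y) k
      / √(selfNormalizer (midSize η n) (projected H η n y) k)

end Statistic

/-- The functional of a path `b : [0,1] → ℝ` that defines the limit `G`:
`sup_{r ∈ [0,1]} (b(r) - r b(1)) / D(r)^{1/2}` with
`D(r) = ∫_0^r (b(s) - (s/r) b(r))² ds + ∫_r^1 (b(1) - b(s) - ((1-s)/(1-r)) (b(1) - b(r)))² ds`. -/
noncomputable def limitFunctional (b : ℝ → ℝ) : ℝ :=
  ⨆ r : unitInterval,
    (b r - r * b 1) /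
      √((∫ s in (0 : ℝ)..r, (b s - s / r * b r) ^ 2)
        + ∫ s in (r : ℝ)..1, (b 1 - b s - (1 - s) / (1 - r) * (b 1 - b r)) ^ 2)

end KernelCPD

namespace KernelCPD

/-! ### The statistic as a function of the partial sums -/

/-! Numerator and denominator of the ratio scale alike, and both are blind to constants, so the
statistic does not change when every `z k` becomes `a * z k + c` with `a > 0` (`gridStat_affine`).
Hence the mean embedding and all normalizing factors drop out, and once `m₁ > 0` the statistic is a
functional `g n` of the partial sum path alone (`testStatistic_eq_gridStat`).

These functionals converge continuously. If paths tend to a continuous path `w` in the Skorokhod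
distance while `n → ∞`, the projected partial sums tend to `r ↦ ⟪D, w (η + r (1 - 2η)) - w η⟫` with
`D = w η - w 1 + w (1 - η)`. The normalizers then tend to their integrals by dominated convergence,
and the suprema converge by compactness of `[0,1]`, provided that the limiting normalizer vanishes
nowhere (`GridTendsto.tendsto_gridStat`). The extended continuous mapping theorem
`TendstoInDistribution.extended_mapping` carries the functional central limit theorem over to the
statistic.

It remains to identify the limit. Up to a null set `D` is built from the increments of `W` before
`η` and after `1 - η`, so it is independent of the increments in between. Given `D = d`, the
projected path is a Brownian motion with variance `(1 - 2η) ⟪S d, d⟫`, which is almost surely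
positive because `S ≠ 0`, and the ratio does not see this random scale. To compare laws without
conditioning on a path space, both the projected path and `B` are sampled along equidistant grids:
their rescaled increments have the same product Gaussian law, and the limit functional is the almost
sure limit of `gridStat` of the increments. Both candidate limits are therefore limits in
distribution of one and the same sequence (`HasBrownianGridLaw.tendstoInDistribution`), and such
limits have a unique law. -/

/-- The statistic `sup_{1 ≤ k ≤ N-1} T(k) / V(k)^{1/2}` of real numbers `z_1, …, z_N`. -/
noncomputable def gridStat (N : ℕ) (z : ℕ → ℝ) : ℝ :=
  ⨆ k : Icc 1 (N - 1), cusum N z k / √(selfNormalizer N z k)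

/-- The part of the self-normalizer that stems from the first `k` partial sums `A_1, …, A_k`. -/
noncomputable def leftNormalizer (N : ℕ) (A : ℕ → ℝ) (k : ℕ) : ℝ :=
  (N : ℝ)⁻¹ * ∑ t ∈ Finset.Icc 1 k, (A t - (t : ℝ) / k * A k) ^ 2

/-- The partial sums of the time-reversed sequence. -/
def reversedSums (N : ℕ) (A : ℕ → ℝ) (t : ℕ) : ℝ := A N - A (N - t)

/-- The self-normalized statistic at `k` in terms of the partial sums `A_1, …, A_N`. -/
noncomputable def sumsRatio (N : ℕ) (A : ℕ → ℝ) (k : ℕ) : ℝ :=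
  (A k - (k : ℝ) / N * A N) /
    √(leftNormalizer N A k + leftNormalizer N (reversedSums N A) (N - k))

lemma sum_Icc_eq_sub_of_le {G : Type*} [AddCommGroup G] (z : ℕ → G) {a n : ℕ} (ha : a ≤ n) :
    ∑ j ∈ Finset.Icc (a + 1) n, z j
      = ∑ j ∈ Finset.Icc 1 n, z j - ∑ j ∈ Finset.Icc 1 a, z j := by
  have h : ∀ m, Finset.Icc (m + 1) n = Finset.Ioc m n := fun m => by ext; simp
  have h0 : ∀ n, Finset.Icc 1 n = Finset.Ioc 0 n := fun n => by ext; simp; omega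
  rw [h, h0, h0, ← Finset.sum_Ioc_consecutive z (Nat.zero_le a) ha, add_sub_cancel_left]

/-- The second sum of the self-normalizer is the first one for the time-reversed sequence, by the
reindexing `t ↦ N + 1 - t`. The factors `N^{-1/2}` of numerator and denominator cancel. -/
lemma cusum_div_sqrt_selfNormalizer (N : ℕ) (z : ℕ → ℝ) {k : ℕ} (hkN : k < N) :
    cusum N z k / √(selfNormalizer N z k)
      = sumsRatio N (fun t => ∑ j ∈ Finset.Icc 1 t, z j) k := by
  have hN : (0 : ℝ) < N := by exact_mod_cast (Nat.zero_le k).trans_lt hkN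
  have h2 : ∑ t ∈ Finset.Icc (k + 1) N, (∑ j ∈ Finset.Icc t N, z j
          - ((N : ℝ) - t + 1) / ((N : ℝ) - k) * ∑ j ∈ Finset.Icc (k + 1) N, z j) ^ 2
      = ∑ u ∈ Finset.Icc 1 (N - k), (reversedSums N (fun t => ∑ j ∈ Finset.Icc 1 t, z j) u
          - (u : ℝ) / (N - k : ℕ) *
            reversedSums N (fun t => ∑ j ∈ Finset.Icc 1 t, z j) (N - k)) ^ 2 := by
    refine Finset.sum_bij' (fun t _ => N + 1 - t) (fun u _ => N + 1 - u) ?_ ?_ ?_ ?_ ?_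
    · intro t ht; rw [Finset.mem_Icc] at ht ⊢; omega
    · intro t ht; rw [Finset.mem_Icc] at ht ⊢; omega
    · intro t ht; rw [Finset.mem_Icc] at ht; omega
    · intro t ht; rw [Finset.mem_Icc] at ht; omega
    · intro t ht
      rw [Finset.mem_Icc] at ht
      obtain ⟨s, rfl⟩ : ∃ s, t = s + 1 := ⟨t - 1, by omega⟩
      have e1 : N - (N + 1 - (s + 1)) = s := by omega
      have e2 : N - (N - k) = k := by omega
      have e3 : ((N + 1 - (s + 1) : ℕ) : ℝ) = (N : ℝ) - s := by
        rw [Nat.add_sub_add_right, Nat.cast_sub (by omega)]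
      rw [reversedSums, reversedSums, e1, e2, e3, Nat.cast_sub hkN.le,
        sum_Icc_eq_sub_of_le z (by omega : s ≤ N), sum_Icc_eq_sub_of_le z hkN.le]
      push_cast
      ring
  have h3 : selfNormalizer N z k = (N : ℝ)⁻¹ *
      (leftNormalizer N (fun t => ∑ j ∈ Finset.Icc 1 t, z j) k
        + leftNormalizer N (reversedSums N (fun t => ∑ j ∈ Finset.Icc 1 t, z j)) (N - k)) := by
    rw [selfNormalizer, h2, leftNormalizer, leftNormalizer]
    ring
  have h4 : cusum N z k = (√(N : ℝ))⁻¹ *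
      (∑ j ∈ Finset.Icc 1 k, z j - (k : ℝ) / N * ∑ j ∈ Finset.Icc 1 N, z j) := by
    rw [cusum, Finset.sum_sub_distrib, Finset.sum_const, Nat.card_Icc, nsmul_eq_mul]
    simp only [Nat.add_sub_cancel]
    ring
  rw [h3, h4, Real.sqrt_mul (by positivity), Real.sqrt_inv, sumsRatio,
    mul_div_mul_left _ _ (by positivity)]

lemma gridStat_eq_iSup_sumsRatio (N : ℕ) (z : ℕ → ℝ) :
    gridStat N z
      = ⨆ k : Icc 1 (N - 1), sumsRatio N (fun t => ∑ j ∈ Finset.Icc 1 t, z j) k := by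
  refine iSup_congr fun k => cusum_div_sqrt_selfNormalizer N z ?_
  have := k.2.1
  have := k.2.2
  omega

/-- A linear drift is removed by the bridge correction, since `c * t - t / k * (c * k) = 0`. For `k
= 0` the sum is empty. -/
lemma leftNormalizer_affine (N : ℕ) (A : ℕ → ℝ) (a c : ℝ) {A' : ℕ → ℝ} (k : ℕ)
    (h : ∀ t ≤ k, A' t = a * A t + c * t) :
    leftNormalizer N A' k = a ^ 2 * leftNormalizer N A k := by
  have hsum : ∀ t ∈ Finset.Icc 1 k,
      (A' t - (t : ℝ) / k * A' k) ^ 2 = a ^ 2 * (A t - (t : ℝ) / k * A k) ^ 2 := by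
    intro t ht
    rw [Finset.mem_Icc] at ht
    have hk : (k : ℝ) ≠ 0 := by
      have : 0 < k := by omega
      positivity
    rw [h t ht.2, h k le_rfl]
    field_simp
    ring
  rw [leftNormalizer, leftNormalizer, Finset.sum_congr rfl hsum, ← Finset.mul_sum]
  ring

lemma sumsRatio_affine (N : ℕ) (A : ℕ → ℝ) {a : ℝ} (ha : 0 < a) (c : ℝ) {A' : ℕ → ℝ} {k : ℕ}
    (hk : k < N) (h : ∀ t ≤ N, A' t = a * A t + c * t) :
    sumsRatio N A' k = sumsRatio N A k := by
  have hN : (N : ℝ) ≠ 0 := by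
    have : 0 < N := by omega
    positivity
  rw [sumsRatio, sumsRatio, leftNormalizer_affine N A a c k fun t ht => h t (ht.trans hk.le),
    leftNormalizer_affine N (reversedSums N A) a c (N - k), ← mul_add,
    Real.sqrt_mul (by positivity), Real.sqrt_sq ha.le, h k hk.le, h N le_rfl,
    show a * A k + c * k - (k : ℝ) / N * (a * A N + c * N) = a * (A k - (k : ℝ) / N * A N) by
      field_simp; ring,
    mul_div_mul_left _ _ ha.ne']
  · intro t ht
    rw [reversedSums, reversedSums, h N le_rfl, h (N - t) (by omega), Nat.cast_sub (by omega)]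
    ring

/-- This invariance is what self-normalization achieves; it is used for the unknown mean, for the
scaling of the direction and for the random scale in the limit. -/
lemma gridStat_affine (N : ℕ) {a : ℝ} (ha : 0 < a) (c : ℝ) {z z' : ℕ → ℝ}
    (h : ∀ k ∈ Finset.Icc 1 N, z' k = a * z k + c) : gridStat N z' = gridStat N z := by
  rw [gridStat_eq_iSup_sumsRatio, gridStat_eq_iSup_sumsRatio]
  refine iSup_congr fun k => sumsRatio_affine N _ ha c ?_ fun t ht => ?_
  · have := k.2.1
    have := k.2.2
    omega
  · rw [Finset.sum_congr rfl fun j hj => h j (Finset.Icc_subset_Icc_right ht hj),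
      Finset.sum_add_distrib, ← Finset.mul_sum, Finset.sum_const, Nat.card_Icc, nsmul_eq_mul]
    simp only [Nat.add_sub_cancel]
    ring

lemma measurable_gridStat (N : ℕ) : Measurable (gridStat N) := by
  refine Measurable.iSup fun k => ?_
  unfold cusum selfNormalizer
  fun_prop

/-! ### Continuous convergence along grids -/

/-- The filter of the pairs `(i, k)` with `k ≤ N i` for which `i → ∞` and `k / N i → r`. -/
noncomputable def gridFilter (N : ℕ → ℕ) (r : ℝ) : Filter (ℕ × ℕ) :=
  comap Prod.fst atTop ⊓ comap (fun p => (p.2 : ℝ) / N p.1) (𝓝 r) ⊓ 𝓟 {p | p.2 ≤ N p.1}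

/-- Dominated convergence along this filter requires it to be countably generated. -/
instance (N : ℕ → ℕ) (r : ℝ) : (gridFilter N r).IsCountablyGenerated := by
  unfold gridFilter; infer_instance

variable {N : ℕ → ℕ} {r : ℝ}

lemma tendsto_gridFilter {α : Type*} {l : Filter α} {u : α → ℕ × ℕ} :
    Tendsto u l (gridFilter N r) ↔ Tendsto (fun a => (u a).1) l atTop ∧
      Tendsto (fun a => ((u a).2 : ℝ) / N (u a).1) l (𝓝 r) ∧ ∀ᶠ a in l, (u a).2 ≤ N (u a).1 := by
  simp only [gridFilter, tendsto_inf, tendsto_comap_iff, tendsto_principal, and_assoc]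
  rfl

lemma tendsto_fst_gridFilter : Tendsto Prod.fst (gridFilter N r) atTop :=
  (tendsto_gridFilter.1 tendsto_id).1

lemma tendsto_ratio_gridFilter :
    Tendsto (fun p : ℕ × ℕ => (p.2 : ℝ) / N p.1) (gridFilter N r) (𝓝 r) :=
  (tendsto_gridFilter.1 tendsto_id).2.1

lemma eventually_le_gridFilter : ∀ᶠ p in gridFilter N r, p.2 ≤ N p.1 :=
  (tendsto_gridFilter.1 tendsto_id).2.2

lemma eventually_pos_gridFilter (hN : Tendsto N atTop atTop) :
    ∀ᶠ p in gridFilter N r, 0 < N p.1 :=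
  (hN.comp tendsto_fst_gridFilter).eventually_gt_atTop 0

lemma tendsto_top_gridFilter (hN : Tendsto N atTop atTop) :
    Tendsto (fun p : ℕ × ℕ => (p.1, N p.1)) (gridFilter N r) (gridFilter N 1) := by
  refine tendsto_gridFilter.2 ⟨tendsto_fst_gridFilter, ?_, .of_forall fun _ => le_rfl⟩
  refine tendsto_nhds_of_eventually_eq ?_
  filter_upwards [eventually_pos_gridFilter hN] with p hp
  exact div_self (by exact_mod_cast hp.ne')

lemma tendsto_reverse_gridFilter (hN : Tendsto N atTop atTop) :
    Tendsto (fun p : ℕ × ℕ => (p.1, N p.1 - p.2)) (gridFilter N r) (gridFilter N (1 - r)) := by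
  refine tendsto_gridFilter.2 ⟨tendsto_fst_gridFilter, ?_, .of_forall fun _ => Nat.sub_le _ _⟩
  refine (tendsto_ratio_gridFilter.const_sub 1).congr' ?_
  filter_upwards [eventually_pos_gridFilter hN, eventually_le_gridFilter] with p hp hle
  have : (N p.1 : ℝ) ≠ 0 := by exact_mod_cast hp.ne'
  rw [Nat.cast_sub hle]
  field_simp

lemma tendsto_ceil_mul_div {α : Type*} {l : Filter α} {M : α → ℕ} (hM : Tendsto M l atTop)
    {s : ℝ} (hs : 0 ≤ s) : Tendsto (fun a => (⌈(M a : ℝ) * s⌉₊ : ℝ) / M a) l (𝓝 s) := by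
  have h := (tendsto_nat_ceil_mul_div_atTop hs).comp (tendsto_natCast_atTop_atTop.comp hM)
  refine h.congr fun a => ?_
  simp [mul_comm]

lemma ceil_mul_le (n : ℕ) {s : ℝ} (hs : s ≤ 1) : ⌈(n : ℝ) * s⌉₊ ≤ n :=
  Nat.ceil_le.2 (mul_le_of_le_one_right n.cast_nonneg hs)

lemma tendsto_ceil_gridFilter (hN : Tendsto N atTop atTop) {s : ℝ} (hs0 : 0 ≤ s) (hs1 : s ≤ 1) :
    Tendsto (fun p : ℕ × ℕ => (p.1, ⌈(N p.1 : ℝ) * s⌉₊)) (gridFilter N r) (gridFilter N s) :=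
  tendsto_gridFilter.2 ⟨tendsto_fst_gridFilter,
    tendsto_ceil_mul_div (hN.comp tendsto_fst_gridFilter) hs0,
    .of_forall fun _ => ceil_mul_le _ hs1⟩

/-- If infinitely often some grid point has a given property, then such grid points accumulate at
some `r ∈ [0, 1]`. -/
lemma exists_tendsto_gridFilter_of_frequently {P : ℕ → ℕ → ℕ → Prop}
    (h : ∀ j, ∃ᶠ i in atTop, ∃ k ≤ N i, P j i k) :
    ∃ r : unitInterval, ∃ u : ℕ → ℕ × ℕ, ∃ ψ : ℕ → ℕ, StrictMono ψ ∧
      Tendsto u atTop (gridFilter N r) ∧ ∀ j, P (ψ j) (u j).1 (u j).2 := by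
  obtain ⟨φ, hφ, hP⟩ := extraction_forall_of_frequently h
  choose k hk hP using hP
  have hmem : ∀ j, (k j : ℝ) / N (φ j) ∈ Icc (0 : ℝ) 1 := fun j =>
    ⟨by positivity, div_le_one_of_le₀ (by exact_mod_cast hk j) (by positivity)⟩
  obtain ⟨r, hr, ψ, hψ, hlim⟩ := isCompact_Icc.tendsto_subseq hmem
  exact ⟨⟨r, hr⟩, fun j => (φ (ψ j), k (ψ j)), ψ, hψ,
    tendsto_gridFilter.2 ⟨hφ.tendsto_atTop.comp hψ.tendsto_atTop, hlim, .of_forall fun j => hk _⟩,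
    fun j => hP (ψ j)⟩

/-- Continuous convergence along the grids entails convergence of the suprema. -/
lemma tendsto_iSup_of_gridFilter (hN : Tendsto N atTop atTop) {q : ℕ → ℕ → ℝ}
    {Q : unitInterval → ℝ}
    (hq : ∀ r : unitInterval, Tendsto (fun p => q p.1 p.2) (gridFilter N r) (𝓝 (Q r))) :
    Tendsto (fun i => ⨆ k : Icc 1 (N i - 1), q i k) atTop (𝓝 (⨆ r, Q r)) := by
  -- interior grid points approximating `r`
  have hgrid : ∀ r : unitInterval, Tendsto
      (fun i => (i, max 1 (min ⌈(N i : ℝ) * r⌉₊ (N i - 1)))) atTop (gridFilter N r) := by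
    intro r
    refine tendsto_gridFilter.2 ⟨tendsto_id, ?_, ?_⟩
    · have hc := tendsto_ceil_mul_div hN r.2.1
      have h0 : Tendsto (fun i => ((N i : ℝ))⁻¹) atTop (𝓝 0) :=
        tendsto_inv_atTop_zero.comp (tendsto_natCast_atTop_atTop.comp hN)
      refine tendsto_of_tendsto_of_tendsto_of_le_of_le' (by simpa using hc.sub h0)
        (by simpa using hc.add h0) ?_ ?_
      · filter_upwards [hN.eventually_ge_atTop 2] with i hi
        have h1 := ceil_mul_le (N i) r.2.2
        have : (0 : ℝ) < N i := by exact_mod_cast (by omega : 0 < N i)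
        rw [← one_div, ← sub_div]
        gcongr
        rw [sub_le_iff_le_add]
        exact_mod_cast (by omega :
          ⌈(N i : ℝ) * r⌉₊ ≤ max 1 (min ⌈(N i : ℝ) * r⌉₊ (N i - 1)) + 1)
      · filter_upwards [hN.eventually_ge_atTop 2] with i hi
        have : (0 : ℝ) < N i := by exact_mod_cast (by omega : 0 < N i)
        rw [← one_div, ← add_div]
        gcongr
        exact_mod_cast (by omega :
          max 1 (min ⌈(N i : ℝ) * r⌉₊ (N i - 1)) ≤ ⌈(N i : ℝ) * r⌉₊ + 1)
    · filter_upwards [hN.eventually_ge_atTop 2] with i hi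
      omega
  -- An unbounded real supremum would take the default value `0`. Boundedness comes from
  -- compactness: grid points with `q i k > j` for every `j` would accumulate at some `r`, against
  -- the finite limit `Q r`.
  have hbdd : BddAbove (range Q) := by
    have : ∃ C : ℕ, ∀ᶠ i in atTop, ∀ k ≤ N i, q i k ≤ C := by
      by_contra! hcon
      obtain ⟨r, u, ψ, hψ, hu, hP⟩ := exists_tendsto_gridFilter_of_frequently
        (P := fun j i k => (j : ℝ) < q i k) fun j => by
          simpa [Filter.Frequently] using! hcon j
      refine not_tendsto_nhds_of_tendsto_atTop ?_ _ ((hq r).comp hu)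
      exact tendsto_atTop_mono (fun j => (hP j).le)
        (tendsto_natCast_atTop_atTop.comp hψ.tendsto_atTop)
    obtain ⟨C, hC⟩ := this
    refine ⟨C, ?_⟩
    rintro _ ⟨r, rfl⟩
    refine le_of_tendsto ((hq r).comp (hgrid r)) ?_
    filter_upwards [hC, (tendsto_gridFilter.1 (hgrid r)).2.2] with i hi hle
    exact hi _ hle
  have hfin : ∀ i, BddAbove (range fun k : Icc 1 (N i - 1) => q i k) := fun i =>
    (finite_range _).bddAbove
  rw [tendsto_order]
  constructor
  · intro a ha
    obtain ⟨r, hr⟩ := exists_lt_of_lt_ciSup ha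
    filter_upwards [((hq r).comp (hgrid r)).eventually_const_lt hr, hN.eventually_ge_atTop 2]
      with i hi h2
    exact hi.trans_le (le_ciSup (hfin i) ⟨max 1 (min ⌈(N i : ℝ) * r⌉₊ (N i - 1)),
      by rw [mem_Icc]; omega⟩)
  · intro a ha
    by_contra hcon
    -- Maximizers with value at least `a` accumulate at some `r`, which forces `a ≤ Q r`.
    obtain ⟨r, u, ψ, hψ, hu, hP⟩ := exists_tendsto_gridFilter_of_frequently (N := N)
      (P := fun _ i k => a ≤ q i k) fun j => by
        rw [not_eventually] at hcon
        refine (hcon.and_eventually (hN.eventually_ge_atTop 2)).mono fun i hi => ?_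
        have : Nonempty (Icc 1 (N i - 1)) := ⟨⟨1, by rw [mem_Icc]; omega⟩⟩
        obtain ⟨k, hk⟩ := Finite.exists_max fun k : Icc 1 (N i - 1) => q i k
        have h1 := k.2.2
        exact ⟨k, by omega, (not_lt.1 hi.1).trans (ciSup_le hk)⟩
    exact absurd (ge_of_tendsto' ((hq r).comp hu) hP)
      (not_le.2 ((le_ciSup hbdd r).trans_lt ha))

/-! ### Convergence of the statistic for converging partial sums -/

/-- The limit of `leftNormalizer` for partial sums that converge to the path `b`. -/
noncomputable def leftIntegral (b : ℝ → ℝ) (r : ℝ) : ℝ :=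
  ∫ s in (0 : ℝ)..r, (b s - s / r * b r) ^ 2

/-- On the cell `((t - 1) / n, t / n]` the ceiling of `n * s` is `t`, so the Riemann sum is exactly
the integral of a step function. -/
lemma integral_comp_ceil (n : ℕ) (hn : 0 < n) (g : ℕ → ℝ) (k : ℕ) :
    IntervalIntegrable (fun s : ℝ => g ⌈(n : ℝ) * s⌉₊) volume 0 ((k : ℝ) / n) ∧
      ∫ s in (0 : ℝ)..((k : ℝ) / n), g ⌈(n : ℝ) * s⌉₊
        = (n : ℝ)⁻¹ * ∑ t ∈ Finset.Icc 1 k, g t := by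
  have hn' : (0 : ℝ) < n := by exact_mod_cast hn
  induction k with
  | zero => simp
  | succ k ih =>
    have hle : (k : ℝ) / n ≤ ((k + 1 : ℕ) : ℝ) / n := by gcongr; simp
    have hconst : EqOn (fun _ => g (k + 1)) (fun s : ℝ => g ⌈(n : ℝ) * s⌉₊)
        (uIoc ((k : ℝ) / n) (((k + 1 : ℕ) : ℝ) / n)) := by
      intro s hs
      rw [uIoc_of_le hle, mem_Ioc, div_lt_iff₀' hn', le_div_iff₀' hn'] at hs
      have : ⌈(n : ℝ) * s⌉₊ = k + 1 :=
        (Nat.ceil_eq_iff (by omega)).2 ⟨by simpa using hs.1, hs.2⟩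
      simp [this]
    have hint : IntervalIntegrable (fun s : ℝ => g ⌈(n : ℝ) * s⌉₊) volume ((k : ℝ) / n)
        (((k + 1 : ℕ) : ℝ) / n) := intervalIntegrable_const.congr hconst
    refine ⟨ih.1.trans hint, ?_⟩
    rw [← intervalIntegral.integral_add_adjacent_intervals ih.1 hint, ih.2,
      ← intervalIntegral.integral_congr_ae (.of_forall fun s hs => hconst hs), intervalIntegral.integral_const,
      Finset.sum_Icc_succ_top (by omega), smul_eq_mul, mul_add]
    push_cast
    field_simp
    ring

variable {N : ℕ → ℕ} {A : ℕ → ℕ → ℝ} {b : ℝ → ℝ}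

/-- The rows `A i 0, …, A i (N i)` converge continuously to the path `b` on `[0,1]`. -/
structure GridTendsto (N : ℕ → ℕ) (A : ℕ → ℕ → ℝ) (b : ℝ → ℝ) : Prop where
  tendsto : ∀ r : unitInterval, Tendsto (fun p => A p.1 p.2) (gridFilter N r) (𝓝 (b r))
  bounded : ∃ C, ∀ᶠ i in atTop, ∀ k ≤ N i, |A i k| ≤ C

lemma GridTendsto.reversed (hN : Tendsto N atTop atTop) (h : GridTendsto N A b) :
    GridTendsto N (fun i => reversedSums (N i) (A i)) (fun s => b 1 - b (1 - s)) where
  tendsto r := by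
    have h1 := (h.tendsto 1).comp (tendsto_top_gridFilter (r := r) hN)
    have h2 := (h.tendsto (unitInterval.symm r)).comp (tendsto_reverse_gridFilter (r := r) hN)
    simpa using! h1.sub h2
  bounded := by
    obtain ⟨C, hC⟩ := h.bounded
    refine ⟨C + C, hC.mono fun i hi k hk => ?_⟩
    exact (abs_sub _ _).trans (add_le_add (hi _ le_rfl) (hi _ (Nat.sub_le _ _)))

lemma GridTendsto.tendsto_leftNormalizer (hN : Tendsto N atTop atTop) (h : GridTendsto N A b)
    (r : unitInterval) :
    Tendsto (fun p => leftNormalizer (N p.1) (A p.1) p.2) (gridFilter N r)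
      (𝓝 (leftIntegral b r)) := by
  obtain ⟨C, hC⟩ := h.bounded
  -- The endpoint `k / N` moves along the filter; an indicator puts all integrals on the fixed
  -- domain `(0, 1]`. Pointwise convergence may then fail only at `s = r`, a null set.
  have hind : ∀ (f : ℝ → ℝ) {c : ℝ}, c ∈ Icc (0 : ℝ) 1 →
      ∫ s in (0 : ℝ)..c, f s = ∫ s in Ioc (0 : ℝ) 1, (Iic c).indicator f s := by
    intro f c hc
    rw [intervalIntegral.integral_of_le hc.1, integral_indicator measurableSet_Iic,
      Measure.restrict_restrict measurableSet_Iic, inter_comm, Ioc_inter_Iic, min_eq_right hc.2]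
  have hsum : ∀ᶠ p in gridFilter N r, ∫ s in Ioc (0 : ℝ) 1,
      (Iic ((p.2 : ℝ) / N p.1)).indicator (fun s => (A p.1 ⌈(N p.1 : ℝ) * s⌉₊ -
        (⌈(N p.1 : ℝ) * s⌉₊ : ℝ) / p.2 * A p.1 p.2) ^ 2) s
        = leftNormalizer (N p.1) (A p.1) p.2 := by
    filter_upwards [eventually_pos_gridFilter hN, eventually_le_gridFilter] with p hp hle
    rw [← hind _ ⟨by positivity, div_le_one_of_le₀ (by exact_mod_cast hle) (by positivity)⟩]
    exact (integral_comp_ceil (N p.1) hp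
      (fun t => (A p.1 t - (t : ℝ) / p.2 * A p.1 p.2) ^ 2) p.2).2
  refine Tendsto.congr' hsum ?_
  rw [leftIntegral, hind _ r.2]
  refine tendsto_integral_filter_of_dominated_convergence (fun _ => (C + C) ^ 2) ?_ ?_
    (integrable_const _) ?_
  · refine .of_forall fun p => (Measurable.indicator ?_ measurableSet_Iic).aestronglyMeasurable
    have h1 : Measurable fun t : ℕ => (A p.1 t - (t : ℝ) / p.2 * A p.1 p.2) ^ 2 :=
      measurable_from_top
    have h2 : Measurable fun s : ℝ => ⌈(N p.1 : ℝ) * s⌉₊ :=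
      Nat.measurable_ceil.comp (measurable_const_mul (N p.1 : ℝ))
    exact h1.comp h2
  · filter_upwards [eventually_pos_gridFilter hN, eventually_le_gridFilter,
      tendsto_fst_gridFilter.eventually hC] with p hp hle hCp
    filter_upwards [ae_restrict_mem measurableSet_Ioc] with s hs
    have hC0 : 0 ≤ C := (abs_nonneg _).trans (hCp _ le_rfl)
    by_cases hsk : s ∈ Iic ((p.2 : ℝ) / N p.1)
    · rw [indicator_of_mem hsk, norm_pow, Real.norm_eq_abs]
      rw [mem_Iic, le_div_iff₀' (by exact_mod_cast hp)] at hsk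
      have h1 : ⌈(N p.1 : ℝ) * s⌉₊ ≤ p.2 := Nat.ceil_le.2 hsk
      -- The weight `t / k` never exceeds `1` for `t ≤ k`; this makes the bound uniform even when `k
      -- / N → 0`.
      have h2 : |(⌈(N p.1 : ℝ) * s⌉₊ : ℝ) / p.2 * A p.1 p.2| ≤ C := by
        rw [abs_mul, abs_of_nonneg (by positivity)]
        refine (mul_le_of_le_one_left (abs_nonneg _) ?_).trans (hCp _ hle)
        exact div_le_one_of_le₀ (by exact_mod_cast h1) (by positivity)
      gcongr
      exact (abs_sub _ _).trans (add_le_add (hCp _ (h1.trans hle)) h2)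
    · rw [indicator_of_notMem hsk, norm_zero]
      positivity
  · have hne : ∀ᵐ s ∂(volume.restrict (Ioc (0 : ℝ) 1)), s ≠ (r : ℝ) :=
      ae_restrict_of_ae (by simp [ae_iff])
    filter_upwards [ae_restrict_mem measurableSet_Ioc, hne] with s hs hsr
    rcases lt_or_gt_of_ne hsr with hlt | hgt
    · rw [indicator_of_mem (mem_Iic.2 hlt.le)]
      have hr0 : (r : ℝ) ≠ 0 := (hs.1.trans hlt).ne'
      have h1 : Tendsto (fun p : ℕ × ℕ => A p.1 ⌈(N p.1 : ℝ) * s⌉₊) (gridFilter N r) (𝓝 (b s)) :=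
        (h.tendsto ⟨s, hs.1.le, hs.2⟩).comp (tendsto_ceil_gridFilter hN hs.1.le hs.2)
      have h2 : Tendsto (fun p : ℕ × ℕ => (⌈(N p.1 : ℝ) * s⌉₊ : ℝ) / p.2) (gridFilter N r)
          (𝓝 (s / r)) := by
        refine ((tendsto_ceil_mul_div (hN.comp tendsto_fst_gridFilter) hs.1.le).div
          tendsto_ratio_gridFilter hr0).congr' ?_
        filter_upwards [eventually_pos_gridFilter hN] with p hp
        have : (N p.1 : ℝ) ≠ 0 := by exact_mod_cast hp.ne'
        simp only [Pi.div_apply, Function.comp_apply]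
        rw [div_div_div_cancel_right₀ this]
      refine ((h1.sub (h2.mul (h.tendsto r))).pow 2).congr' ?_
      filter_upwards [tendsto_ratio_gridFilter.eventually_const_lt hlt] with p hp
      rw [indicator_of_mem (mem_Iic.2 hp.le)]
    · rw [indicator_of_notMem (by simpa using hgt)]
      refine tendsto_nhds_of_eventually_eq ?_
      filter_upwards [tendsto_ratio_gridFilter.eventually_lt_const hgt] with p hp
      rw [indicator_of_notMem (by simpa using hp)]

/-- The denominator of `limitFunctional`, before taking the square root. -/
noncomputable def limitNormalizer (b : ℝ → ℝ) (r : ℝ) : ℝ :=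
  leftIntegral b r + leftIntegral (fun s => b 1 - b (1 - s)) (1 - r)

/-- The substitution `s ↦ 1 - s` turns the integral over `[r, 1]` into the left integral of the
reversed path. -/
lemma limitFunctional_eq (b : ℝ → ℝ) :
    limitFunctional b
      = ⨆ r : unitInterval, (b r - r * b 1) / √(limitNormalizer b r) := by
  refine iSup_congr fun r => ?_
  congr 3
  have := intervalIntegral.integral_comp_sub_left (a := (r : ℝ)) (b := 1)
    (fun u => ((b 1 - b (1 - u)) - u / (1 - r) * (b 1 - b (1 - (1 - r)))) ^ 2) 1
  rw [leftIntegral]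
  simpa using this

theorem GridTendsto.tendsto_gridStat (hN : Tendsto N atTop atTop) {z : ℕ → ℕ → ℝ}
    (h : GridTendsto N (fun i k => ∑ j ∈ Finset.Icc 1 k, z i j) b)
    (hpos : ∀ r : unitInterval, 0 < limitNormalizer b r) :
    Tendsto (fun i => gridStat (N i) (z i)) atTop (𝓝 (limitFunctional b)) := by
  simp_rw [limitFunctional_eq, gridStat_eq_iSup_sumsRatio]
  refine tendsto_iSup_of_gridFilter hN fun r => ?_
  refine Tendsto.div ?_ (Tendsto.sqrt ?_) (Real.sqrt_pos.2 (hpos r)).ne'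
  · have h1 := h.tendsto 1
    rw [Set.Icc.coe_one] at h1
    have h2 := h1.comp (tendsto_top_gridFilter (r := r) hN)
    have h3 := h.tendsto r
    have h4 := h3.sub ((tendsto_ratio_gridFilter (N := N) (r := r)).mul h2)
    simpa only [Function.comp_def] using h4
  · have h2 := (h.reversed hN).tendsto_leftNormalizer hN (unitInterval.symm r)
    rw [unitInterval.coe_symm_eq] at h2
    have h3 := h2.comp (tendsto_reverse_gridFilter (r := r) hN)
    have h4 := (h.tendsto_leftNormalizer hN r).add h3
    simpa only [Function.comp_def, limitNormalizer] using h4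

/-! ### Positivity of the limiting normalizer -/

lemma leftIntegral_nonneg (b : ℝ → ℝ) {r : ℝ} (hr : 0 ≤ r) : 0 ≤ leftIntegral b r :=
  intervalIntegral.integral_nonneg hr fun _ _ => sq_nonneg _

/-- A vanishing continuous integrand makes `b` linear on `[0, r]`, which contains `1 / 4` and `1 /
2`. -/
lemma leftIntegral_pos {r : ℝ} (hb : ContinuousOn b (Icc 0 1)) (hr : 1 / 2 ≤ r) (hr1 : r ≤ 1)
    (hne : b (1 / 2) ≠ 2 * b (1 / 4)) : 0 < leftIntegral b r := by
  have hr0 : 0 < r := by linarith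
  refine intervalIntegral.integral_pos hr0 ?_ (fun _ _ => sq_nonneg _) ?_
  · have := hb.mono (Icc_subset_Icc_right hr1)
    fun_prop
  · by_contra! hcon
    have h0 : ∀ c ∈ Icc 0 r, b c = c / r * b r := fun c hc =>
      sub_eq_zero.1 (pow_eq_zero_iff two_ne_zero |>.1 (le_antisymm (hcon c hc) (sq_nonneg _)))
    refine hne ?_
    rw [h0 (1 / 2) ⟨by norm_num, hr⟩, h0 (1 / 4) ⟨by norm_num, by linarith⟩]
    ring

/-- One of `[0, r]` and `[r, 1]` has length at least `1 / 2`. Two conditions on the path at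
multiples of `1 / 4` thus serve all `r` at once. -/
lemma limitNormalizer_pos (hb : ContinuousOn b (Icc 0 1)) (hne : b (1 / 2) ≠ 2 * b (1 / 4))
    (hne' : b 1 - b (1 / 2) ≠ 2 * (b 1 - b (3 / 4))) (r : unitInterval) :
    0 < limitNormalizer b r := by
  have h1 := r.2.1
  have h2 := r.2.2
  rcases le_total (1 / 2) (r : ℝ) with hr | hr
  · exact add_pos_of_pos_of_nonneg (leftIntegral_pos hb hr h2 hne)
      (leftIntegral_nonneg _ (by linarith))
  · refine add_pos_of_nonneg_of_pos (leftIntegral_nonneg _ h1)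
      (leftIntegral_pos ?_ (by linarith) (by linarith) (by norm_num; simpa using hne'))
    refine continuousOn_const.sub (hb.comp (by fun_prop) fun s hs => ?_)
    exact ⟨by linarith [hs.2], by linarith [hs.1]⟩

/-! ### The extended continuous mapping theorem -/

/-- A point that is a limit of points of `g n ⁻¹' C` with `n → ∞` is sent to `C` by the
continuous limit of the maps `g n`. -/
lemma mem_of_mem_iInter_closure {E F : Type*} [PseudoEMetricSpace E]
    [TopologicalSpace F] {g : ℕ → E → F} {C : Set F} (hC : IsClosed C) {x : E} {y : F}
    (hconv : ∀ (φ : ℕ → ℕ) (u : ℕ → E), Tendsto φ atTop atTop → Tendsto u atTop (𝓝 x) →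
      Tendsto (fun j => g (φ j) (u j)) atTop (𝓝 y))
    (hx : x ∈ ⋂ m : ℕ, closure (⋃ n ≥ m, g n ⁻¹' C)) : y ∈ C := by
  have hpt : ∀ m : ℕ, ∃ n ≥ m, ∃ u : E, g n u ∈ C ∧ edist x u < (m : ℝ≥0∞)⁻¹ := by
    intro m
    obtain ⟨u, hu, hlt⟩ := EMetric.mem_closure_iff.1 (mem_iInter.1 hx m) (m : ℝ≥0∞)⁻¹
      (by simp)
    simp only [mem_iUnion, mem_preimage, exists_prop] at hu
    obtain ⟨n, hn, hun⟩ := hu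
    exact ⟨n, hn, u, hun, hlt⟩
  choose φ hφ u hu hlt using hpt
  refine hC.mem_of_tendsto (hconv φ u (tendsto_atTop_mono hφ tendsto_id) ?_) (.of_forall hu)
  rw [tendsto_iff_edist_tendsto_0]
  refine tendsto_of_tendsto_of_tendsto_of_le_of_le tendsto_const_nhds
    ENNReal.tendsto_inv_nat_nhds_zero (fun _ => zero_le) fun m => ?_
  rw [edist_comm]
  exact (hlt m).le

section ExtendedMapping

variable {Ω Ω' E F : Type*} [MeasurableSpace Ω] [MeasurableSpace Ω'] [PseudoEMetricSpace E]
  [MeasurableSpace E] [BorelSpace E] [TopologicalSpace F] [MeasurableSpace F]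
  [OpensMeasurableSpace F] {μ : Measure Ω} [IsProbabilityMeasure μ] {ν : Measure Ω'}
  [IsProbabilityMeasure ν]

/-- **Extended continuous mapping theorem.** If `X n → Z` in distribution and the maps `g n`
converge continuously at almost every value of `Z`, then `g n (X n)` converges in distribution. -/
theorem _root_.MeasureTheory.TendstoInDistribution.extended_mapping {X : ℕ → Ω → E} {Z : Ω' → E}
    (hX : TendstoInDistribution X atTop Z (fun _ => μ) ν) {g : ℕ → E → F} {T : ℕ → Ω → F}
    {T' : Ω' → F} (hT : ∀ n, AEMeasurable (T n) μ) (hT' : AEMeasurable T' ν)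
    (hTg : ∀ᶠ n in atTop, ∀ ω, T n ω = g n (X n ω))
    (hconv : ∀ᵐ ω ∂ν, ∀ (φ : ℕ → ℕ) (u : ℕ → E), Tendsto φ atTop atTop →
      Tendsto u atTop (𝓝 (Z ω)) → Tendsto (fun j => g (φ j) (u j)) atTop (𝓝 (T' ω))) :
    TendstoInDistribution T atTop T' (fun _ => μ) ν := by
  refine ⟨hT, hT', tendsto_of_forall_isClosed_limsup_le' fun C hC => ?_⟩
  -- The preimages `g n ⁻¹' C` need not be measurable, but these closures are closed. The
  -- portmanteau theorem bounds the limsup by the mass of each `K m`; then `m → ∞`, and a value of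
  -- `Z` lying in all `K m` has its image in `C`.
  set K : ℕ → Set E := fun m => closure (⋃ n ≥ m, g n ⁻¹' C) with hK
  have hKc : ∀ m, IsClosed (K m) := fun m => isClosed_closure
  have hKanti : Antitone K := fun m m' h =>
    closure_mono (biUnion_subset_biUnion_left fun n hn => h.trans hn)
  have h1 : ∀ m, limsup (fun n => μ.map (T n) C) atTop ≤ ν.map Z (K m) := by
    intro m
    refine le_trans (limsup_le_limsup ?_)
      (ProbabilityMeasure.limsup_measure_closed_le_of_tendsto hX.tendsto (hKc m))
    filter_upwards [hTg, eventually_ge_atTop m] with n hn hm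
    simp only [ProbabilityMeasure.coe_mk]
    rw [Measure.map_apply_of_aemeasurable (hT n) hC.measurableSet,
      Measure.map_apply_of_aemeasurable (hX.forall_aemeasurable n) (hKc m).measurableSet]
    refine measure_mono fun ω hω => subset_closure (mem_biUnion (show n ≥ m from hm) ?_)
    rwa [mem_preimage, hn ω] at hω
  have := Measure.isProbabilityMeasure_map (μ := ν) hX.aemeasurable_limit
  have h2 := tendsto_measure_iInter_atTop (μ := ν.map Z)
    (fun m => (hKc m).measurableSet.nullMeasurableSet) hKanti ⟨0, measure_ne_top _ _⟩
  refine (ge_of_tendsto' h2 h1).trans ?_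
  simp only [ProbabilityMeasure.coe_mk]
  rw [Measure.map_apply_of_aemeasurable hT' hC.measurableSet,
    Measure.map_apply_of_aemeasurable hX.aemeasurable_limit
      (isClosed_iInter hKc).measurableSet]
  refine measure_mono_ae ?_
  filter_upwards [hconv] with ω hω hmem
  exact mem_of_mem_iInter_closure hC hω hmem

end ExtendedMapping

/-! ### The law of the limit -/

section GridLaw

variable {Ω : Type*} [MeasurableSpace Ω] {P : Measure Ω}

/-- The difference is Gaussian with positive variance, hence has no atom at `0`. -/
lemma ae_ne_of_indepFun_gaussianReal {X Y : Ω → ℝ} {m m' : ℝ} {v v' : ℝ≥0}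
    (hX : HasLaw X (gaussianReal m v) P) (hY : HasLaw Y (gaussianReal m' v') P) (hv : v ≠ 0)
    (h : IndepFun X Y P) : ∀ᵐ ω ∂P, X ω ≠ Y ω := by
  have hsum : HasLaw (X + -Y) (gaussianReal (m + -m') (v + v')) P := by
    have hY' := gaussianReal_neg hY
    refine ⟨hX.aemeasurable.add hY'.aemeasurable, ?_⟩
    exact gaussianReal_add_gaussianReal_of_indepFun
      (h.comp measurable_id measurable_neg) hX.map_eq hY'.map_eq
  have hne : ∀ᵐ x ∂(gaussianReal (m + -m') (v + v')), x ≠ 0 := by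
    have := nullSingletonClass_gaussianReal (μ := m + -m') (v := v + v') (by simp [hv])
    simp [ae_iff]
  rw [← hsum.ae_iff (p := fun x => x ≠ 0) (by fun_prop)] at hne
  filter_upwards [hne] with ω hω heq
  simp [heq] at hω

/-- A process on `[0,1]` with continuous paths whose increments along equidistant grids are
independent centred Gaussian after division by a random scale `σ`. -/
structure HasBrownianGridLaw (X : ℝ → Ω → ℝ) (σ : Ω → ℝ) (P : Measure Ω) : Prop where
  start_zero : ∀ᵐ ω ∂P, X 0 ω = 0
  scale_pos : ∀ᵐ ω ∂P, 0 < σ ω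
  continuousOn : ∀ᵐ ω ∂P, ContinuousOn (fun t => X t ω) (Icc 0 1)
  law : ∀ m : ℕ, HasLaw
    (fun ω (k : Fin (m + 1)) => (X ((k + 1 : ℕ) / (m + 1 : ℕ)) ω - X (k / (m + 1 : ℕ)) ω) / σ ω)
    (Measure.pi fun _ => gaussianReal 0 ((m + 1 : ℕ) : ℝ≥0)⁻¹) P

/-- The sequence `z_1, …, z_m, 0, 0, …` with given `z_1, …, z_m`. -/
def extendGrid {m : ℕ} (v : Fin m → ℝ) (k : ℕ) : ℝ :=
  if h : k - 1 < m then v ⟨k - 1, h⟩ else 0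

lemma measurable_gridStat_extendGrid (m : ℕ) :
    Measurable fun v : Fin m → ℝ => gridStat m (extendGrid v) := by
  refine (measurable_gridStat m).comp (measurable_pi_lambda _ fun k => ?_)
  unfold extendGrid
  split_ifs <;> fun_prop

variable {X : ℝ → Ω → ℝ} {σ : Ω → ℝ}

lemma gridTendsto_increments {b : ℝ → ℝ} (hb0 : b 0 = 0) (hb : ContinuousOn b (Icc 0 1)) :
    GridTendsto (fun m => m + 1) (fun m k => ∑ j ∈ Finset.Icc 1 k,
      (b ((j : ℝ) / (m + 1 : ℕ)) - b ((j - 1 : ℕ) / (m + 1 : ℕ)))) b := by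
  have hsum : ∀ m k : ℕ, ∑ j ∈ Finset.Icc 1 k,
      (b ((j : ℝ) / (m + 1 : ℕ)) - b ((j - 1 : ℕ) / (m + 1 : ℕ))) = b ((k : ℝ) / (m + 1 : ℕ)) := by
    intro m k
    induction k with
    | zero => simp [hb0]
    | succ k ih => rw [Finset.sum_Icc_succ_top (by omega), ih, Nat.add_sub_cancel]; ring
  have hmem : ∀ m k : ℕ, k ≤ m + 1 → (k : ℝ) / (m + 1 : ℕ) ∈ Icc (0 : ℝ) 1 := fun m k h =>
    ⟨by positivity, div_le_one_of_le₀ (by exact_mod_cast h) (by positivity)⟩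
  simp_rw [hsum]
  constructor
  · intro r
    refine (hb r r.2).tendsto.comp (tendsto_nhdsWithin_iff.2 ⟨tendsto_ratio_gridFilter, ?_⟩)
    exact eventually_le_gridFilter.mono fun p hp => hmem _ _ hp
  · obtain ⟨C, hC⟩ := isCompact_Icc.exists_bound_of_continuousOn hb
    exact ⟨C, .of_forall fun m k hk => hC _ (hmem m k hk)⟩

/-- By `limitNormalizer_pos` it suffices that the increments over the first two quarters of `[0,1]`
differ, and likewise over the last two. These are independent Gaussians up to a common positive
scale. -/
lemma HasBrownianGridLaw.ae_limitNormalizer_pos (h : HasBrownianGridLaw X σ P) :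
    ∀ᵐ ω ∂P, ∀ r : unitInterval, 0 < limitNormalizer (fun t => X t ω) r := by
  have hcoord : ∀ i j : Fin 4, i ≠ j →
      ∀ᵐ v ∂(Measure.pi fun _ : Fin 4 => gaussianReal 0 ((3 + 1 : ℕ) : ℝ≥0)⁻¹), v i ≠ v j := by
    intro i j hij
    have hind := iIndepFun_pi (μ := fun _ : Fin 4 => gaussianReal 0 ((3 + 1 : ℕ) : ℝ≥0)⁻¹)
      (X := fun _ x => x) (fun _ => aemeasurable_id)
    have hlaw : ∀ i : Fin 4, HasLaw (fun v : Fin 4 → ℝ => v i)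
        (gaussianReal 0 ((3 + 1 : ℕ) : ℝ≥0)⁻¹)
        (Measure.pi fun _ : Fin 4 => gaussianReal 0 ((3 + 1 : ℕ) : ℝ≥0)⁻¹) := fun i =>
      (measurePreserving_eval (fun _ : Fin 4 => gaussianReal 0 ((3 + 1 : ℕ) : ℝ≥0)⁻¹) i).hasLaw
    exact ae_ne_of_indepFun_gaussianReal (hlaw i) (hlaw j) (by positivity) (hind.indepFun hij)
  have h01 := ((h.law 3).ae_iff (p := fun v => v 0 ≠ v 1)
    (by measurability)).2 (hcoord 0 1 (by decide))
  have h23 := ((h.law 3).ae_iff (p := fun v => v 2 ≠ v 3)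
    (by measurability)).2 (hcoord 2 3 (by decide))
  filter_upwards [h01, h23, h.start_zero, h.scale_pos, h.continuousOn] with ω h1 h2 h0 hσ hc
  refine limitNormalizer_pos hc (fun heq => h1 ?_) (fun heq => h2 ?_)
  · norm_num at heq ⊢
    rw [heq, h0]
    ring
  · norm_num at heq ⊢
    congr 1
    linarith

/-- The approximating laws do not involve `X` or `σ`, so the law of the limit functional is the same
for all such processes. Its measurability, not evident for an uncountable supremum, comes from being
an almost sure limit. -/
lemma HasBrownianGridLaw.tendstoInDistribution [IsProbabilityMeasure P]
    (h : HasBrownianGridLaw X σ P) :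
    TendstoInDistribution
      (fun (m : ℕ) (v : Fin (m + 1) → ℝ) => gridStat (m + 1) (extendGrid v)) atTop
      (fun ω => limitFunctional fun t => X t ω)
      (fun m => Measure.pi fun _ => gaussianReal 0 ((m + 1 : ℕ) : ℝ≥0)⁻¹) P := by
  have hlim : ∀ᵐ ω ∂P, Tendsto (fun m : ℕ => gridStat (m + 1) (extendGrid
      fun k : Fin (m + 1) => (X ((k + 1 : ℕ) / (m + 1 : ℕ)) ω - X (k / (m + 1 : ℕ)) ω) / σ ω))
      atTop (𝓝 (limitFunctional fun t => X t ω)) := by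
    filter_upwards [h.ae_limitNormalizer_pos, h.start_zero, h.scale_pos, h.continuousOn]
      with ω hpos h0 hσ hc
    refine ((gridTendsto_increments h0 hc).tendsto_gridStat (tendsto_add_atTop_nat 1) hpos).congr
      fun m => (gridStat_affine (m + 1) (inv_pos.2 hσ) 0 fun k hk => ?_).symm
    rw [Finset.mem_Icc] at hk
    rw [extendGrid, dif_pos (by omega), Nat.sub_add_cancel hk.1]
    ring
  have hmeas : ∀ m : ℕ, AEMeasurable (fun ω => gridStat (m + 1) (extendGrid
      fun k : Fin (m + 1) => (X ((k + 1 : ℕ) / (m + 1 : ℕ)) ω - X (k / (m + 1 : ℕ)) ω) / σ ω)) P :=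
    fun m => (measurable_gridStat_extendGrid (m + 1)).comp_aemeasurable (h.law m).aemeasurable
  have hconv := tendstoInDistribution_of_ae_tendsto hmeas
    (aemeasurable_of_tendsto_metrizable_ae atTop hmeas hlim) hlim
  refine ⟨fun m => (measurable_gridStat_extendGrid (m + 1)).aemeasurable,
    hconv.aemeasurable_limit, ?_⟩
  refine hconv.tendsto.congr fun m => Subtype.ext ?_
  have hmap := AEMeasurable.map_map_of_aemeasurable
    (measurable_gridStat_extendGrid (m + 1)).aemeasurable (h.law m).aemeasurable
  rw [(h.law m).map_eq] at hmap
  exact hmap.symm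

/-- A standard Brownian motion, restricted to `[0,1]`. -/
lemma hasBrownianGridLaw_of_isBrownianReal {B : ℝ≥0 → Ω → ℝ} (hB : IsBrownianReal B P) :
    HasBrownianGridLaw (fun t => B t.toNNReal) (fun _ => 1) P where
  start_zero := by simpa using hB.eval_zero_ae_eq_zero
  scale_pos := by simp
  continuousOn := by
    filter_upwards [hB.cont] with ω hω
    exact (hω.comp continuous_real_toNNReal).continuousOn
  law m := by
    have hmono : Monotone fun k : Fin (m + 2) => ((k : ℝ) / (m + 1 : ℕ)).toNNReal := by
      intro i j hij
      have : (i : ℝ) ≤ j := by exact_mod_cast hij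
      simp only
      gcongr
    have hind := hB.hasIndepIncrements (m + 1) _ hmono
    have := hind.isProbabilityMeasure
    simp only [div_one]
    refine iIndepFun.hasLaw_pi (fun k => ?_) hind
    have hk := hB.hasLaw_sub ((k + 1 : ℕ) / (m + 1 : ℕ) : ℝ).toNNReal (k / (m + 1 : ℕ) : ℝ).toNNReal
    have hdist : nndist ((k + 1 : ℕ) / (m + 1 : ℕ) : ℝ).toNNReal.1
        ((k : ℕ) / (m + 1 : ℕ) : ℝ).toNNReal.1 = ((m + 1 : ℕ) : ℝ≥0)⁻¹ := by
      rw [← NNReal.coe_inj, coe_nndist, Real.dist_eq, NNReal.val_eq_coe, NNReal.val_eq_coe,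
        Real.coe_toNNReal _ (by positivity), Real.coe_toNNReal _ (by positivity), ← sub_div,
        abs_of_nonneg (by push_cast; simp; positivity)]
      push_cast
      simp
    rw [hdist] at hk
    exact hk

end GridLaw

/-! ### Convergence of cadlag paths to a continuous path -/

section Paths

variable {α H : Type*} {l : Filter α}

namespace CadlagPath

lemma exists_orderIso_of_edist_lt [PseudoEMetricSpace H] {f g : CadlagPath H} {δ : ℝ≥0∞}
    (h : edist f g < δ) : ∃ lam : unitInterval ≃o unitInterval,
      ∀ t, edist (f t) (g (lam t)) < δ ∧ edist t (lam t) < δ := by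
  obtain ⟨lam, hlam⟩ := iInf_lt_iff.1 (show skorokhodDist f g < δ from h)
  refine ⟨lam, fun t => ⟨?_, ?_⟩⟩
  · exact ((le_iSup (fun t => edist (f t) (g (lam t))) t).trans le_self_add).trans_lt hlam
  · exact ((le_iSup (fun t => edist t (lam t)) t).trans le_add_self).trans_lt hlam

/-- Skorokhod convergence to a continuous path is continuous convergence. -/
lemma tendsto_apply [PseudoEMetricSpace H] {u : α → CadlagPath H} {w : CadlagPath H}
    (hw : Continuous w.toFun) (hu : Tendsto u l (𝓝 w)) {t : α → unitInterval} {t₀ : unitInterval}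
    (ht : Tendsto t l (𝓝 t₀)) : Tendsto (fun a => u a (t a)) l (𝓝 (w t₀)) := by
  rw [EMetric.tendsto_nhds]
  intro ε hε
  have hε2 : 0 < ε / 2 := ENNReal.half_pos hε.ne'
  -- The path `u a` at time `t a` is close to `w` at the shifted time `lam (t a)`. That time is
  -- close to `t₀`, so continuity of `w` at `t₀` finishes.
  obtain ⟨δ, hδ, hwδ⟩ := EMetric.tendsto_nhds_nhds.1 (hw.tendsto t₀) (ε / 2) hε2
  have hδ2 : 0 < δ / 2 := ENNReal.half_pos hδ.ne'
  filter_upwards [EMetric.tendsto_nhds.1 hu (min (ε / 2) (δ / 2)) (lt_min hε2 hδ2),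
    EMetric.tendsto_nhds.1 ht (δ / 2) hδ2] with a ha hta
  obtain ⟨lam, hlam⟩ := exists_orderIso_of_edist_lt ha
  obtain ⟨h1, h2⟩ := hlam (t a)
  have h3 : edist (lam (t a)) t₀ < δ := by
    refine (edist_triangle _ (t a) _).trans_lt ?_
    rw [← ENNReal.add_halves δ, edist_comm _ (t a)]
    exact ENNReal.add_lt_add (h2.trans_le (min_le_right _ _)) hta
  refine (edist_triangle _ (w (lam (t a))) _).trans_lt ?_
  rw [← ENNReal.add_halves ε]
  exact ENNReal.add_lt_add (h1.trans_le (min_le_left _ _)) (hwδ h3)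

lemma exists_eventually_norm_le [SeminormedAddCommGroup H] {u : α → CadlagPath H}
    {w : CadlagPath H} (hw : Continuous w.toFun) (hu : Tendsto u l (𝓝 w)) :
    ∃ C, ∀ᶠ a in l, ∀ t, ‖u a t‖ ≤ C := by
  obtain ⟨C, hC⟩ := isCompact_univ.exists_bound_of_continuousOn hw.continuousOn
  refine ⟨1 + C, ?_⟩
  filter_upwards [EMetric.tendsto_nhds.1 hu 1 one_pos] with a ha t
  obtain ⟨lam, hlam⟩ := exists_orderIso_of_edist_lt ha
  have h1 := (hlam t).1
  rw [edist_dist, ENNReal.ofReal_lt_one, dist_eq_norm] at h1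
  calc ‖u a t‖ = ‖(u a t - w (lam t)) + w (lam t)‖ := by rw [sub_add_cancel]
    _ ≤ 1 + C := (norm_add_le _ _).trans (add_le_add h1.le (hC _ (mem_univ _)))

end CadlagPath

/-- The projection of the real line onto the time interval `[0,1]`. -/
noncomputable def unitTime (x : ℝ) : unitInterval := projIcc 0 1 zero_le_one x

lemma continuous_unitTime : Continuous unitTime :=
  continuous_projIcc (h := zero_le_one)

lemma coe_unitTime {x : ℝ} (hx : x ∈ Icc (0 : ℝ) 1) : (unitTime x : ℝ) = x := by
  rw [unitTime, projIcc_of_mem _ hx]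

lemma unitTime_one : unitTime 1 = 1 := projIcc_right zero_le_one

lemma unitTime_mono : Monotone unitTime := monotone_projIcc zero_le_one

/-! ### The statistic as a functional of the partial sum path -/

section PathStatistic

variable [NormedAddCommGroup H] {η : ℝ}

/-- The projection direction of the path `w` after `n` observations, up to a positive factor. -/
noncomputable def pathDirection (η : ℝ) (n : ℕ) (w : CadlagPath H) : H :=
  w (unitTime (splitSize η n / n)) - w 1 + w (unitTime ((n - splitSize η n : ℕ) / n))

/-- The limit of `pathDirection`. -/
noncomputable def limitDirection (η : ℝ) (w : CadlagPath H) : H :=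
  w (unitTime η) - w 1 + w (unitTime (1 - η))

lemma two_mul_splitSize_le (hη : η ∈ Ioo (0 : ℝ) (1 / 2)) (n : ℕ) : 2 * splitSize η n ≤ n := by
  have h1 : (splitSize η n : ℝ) ≤ n * η :=
    Nat.floor_le (mul_nonneg n.cast_nonneg hη.1.le)
  have h2 : (n : ℝ) * η ≤ n * (1 / 2) := by gcongr; exact hη.2.le
  have h3 : (2 * splitSize η n : ℝ) ≤ n := by linarith
  exact_mod_cast h3

lemma tendsto_splitSize_div (hη : 0 ≤ η) :
    Tendsto (fun n : ℕ => (splitSize η n : ℝ) / n) atTop (𝓝 η) := by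
  refine ((tendsto_nat_floor_mul_div_atTop hη).comp tendsto_natCast_atTop_atTop).congr fun n => ?_
  simp [splitSize, mul_comm]

lemma tendsto_splitSize_atTop (hη : 0 < η) : Tendsto (splitSize η) atTop atTop :=
  tendsto_nat_floor_atTop.comp (tendsto_natCast_atTop_atTop.atTop_mul_const hη)

lemma tendsto_midSize_div (hη : η ∈ Ioo (0 : ℝ) (1 / 2)) :
    Tendsto (fun n : ℕ => (midSize η n : ℝ) / n) atTop (𝓝 (1 - 2 * η)) := by
  refine (((tendsto_splitSize_div hη.1.le).const_mul 2).const_sub 1).congr' ?_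
  filter_upwards [eventually_gt_atTop 0] with n hn
  have : (n : ℝ) ≠ 0 := by positivity
  rw [midSize, Nat.cast_sub (two_mul_splitSize_le hη n)]
  push_cast
  field_simp

lemma tendsto_midSize_atTop (hη : η ∈ Ioo (0 : ℝ) (1 / 2)) :
    Tendsto (midSize η) atTop atTop := by
  have h := (tendsto_midSize_div hη).pos_mul_atTop (by linarith [hη.2])
    tendsto_natCast_atTop_atTop
  rw [← tendsto_natCast_atTop_iff (R := ℝ)]
  refine h.congr' ?_
  filter_upwards [eventually_gt_atTop 0] with n hn
  have : (n : ℝ) ≠ 0 := by positivity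
  field_simp

lemma tendsto_pathDirection (hη : η ∈ Ioo (0 : ℝ) (1 / 2)) {φ : α → ℕ} {u : α → CadlagPath H}
    {w : CadlagPath H} (hw : Continuous w.toFun) (hφ : Tendsto φ l atTop)
    (hu : Tendsto u l (𝓝 w)) :
    Tendsto (fun a => pathDirection η (φ a) (u a)) l (𝓝 (limitDirection η w)) := by
  have h1 := (tendsto_splitSize_div hη.1.le).comp hφ
  have h2 : Tendsto (fun a => ((φ a - splitSize η (φ a) : ℕ) : ℝ) / φ a) l (𝓝 (1 - η)) := by
    refine (h1.const_sub 1).congr' ?_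
    filter_upwards [hφ.eventually_gt_atTop 0] with a ha
    have : (φ a : ℝ) ≠ 0 := by positivity
    have := two_mul_splitSize_le hη (φ a)
    rw [Nat.cast_sub (by omega)]
    simp only [Function.comp_apply]
    field_simp
  refine Tendsto.add (Tendsto.sub ?_ ?_) ?_
  · exact CadlagPath.tendsto_apply hw hu ((continuous_unitTime.tendsto _).comp h1)
  · exact CadlagPath.tendsto_apply hw hu tendsto_const_nhds
  · exact CadlagPath.tendsto_apply hw hu ((continuous_unitTime.tendsto _).comp h2)

variable [InnerProductSpace ℝ H]

/-- The projected increments of the path `w` over the middle subsample. -/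
noncomputable def pathIncrement (η : ℝ) (n : ℕ) (w : CadlagPath H) (k : ℕ) : ℝ :=
  ⟪pathDirection η n w, w (unitTime ((splitSize η n + k : ℕ) / n))
    - w (unitTime ((splitSize η n + (k - 1) : ℕ) / n))⟫

/-- The limit of the partial sums of `pathIncrement`. -/
noncomputable def projectedPath (η : ℝ) (w : CadlagPath H) (r : ℝ) : ℝ :=
  ⟪limitDirection η w, w (unitTime (η + r * (1 - 2 * η))) - w (unitTime η)⟫

lemma sum_pathIncrement (n : ℕ) (w : CadlagPath H) (k : ℕ) :
    ∑ j ∈ Finset.Icc 1 k, pathIncrement η n w j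
      = ⟪pathDirection η n w, w (unitTime ((splitSize η n + k : ℕ) / n))
          - w (unitTime (splitSize η n / n))⟫ := by
  induction k with
  | zero => simp
  | succ k ih =>
    rw [Finset.sum_Icc_succ_top (by omega), ih, pathIncrement, ← inner_add_right,
      Nat.add_sub_cancel]
    congr 1
    abel

lemma gridTendsto_pathIncrement (hη : η ∈ Ioo (0 : ℝ) (1 / 2)) {φ : ℕ → ℕ}
    {u : ℕ → CadlagPath H} {w : CadlagPath H} (hw : Continuous w.toFun)
    (hφ : Tendsto φ atTop atTop) (hu : Tendsto u atTop (𝓝 w)) :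
    GridTendsto (fun i => midSize η (φ i))
      (fun i k => ∑ j ∈ Finset.Icc 1 k, pathIncrement η (φ i) (u i) j) (projectedPath η w) := by
  simp_rw [sum_pathIncrement]
  constructor
  · intro r
    have hφ' : Tendsto (fun p : ℕ × ℕ => φ p.1) (gridFilter (fun i => midSize η (φ i)) r) atTop :=
      hφ.comp tendsto_fst_gridFilter
    have hu' := hu.comp (tendsto_fst_gridFilter (N := fun i => midSize η (φ i)) (r := r))
    have h1 := (tendsto_splitSize_div hη.1.le).comp hφ'
    have h2 : Tendsto (fun p : ℕ × ℕ => ((splitSize η (φ p.1) + p.2 : ℕ) : ℝ) / φ p.1)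
        (gridFilter (fun i => midSize η (φ i)) r) (𝓝 (η + r * (1 - 2 * η))) := by
      refine (h1.add (tendsto_ratio_gridFilter.mul
        ((tendsto_midSize_div hη).comp hφ'))).congr' ?_
      filter_upwards [hφ'.eventually_gt_atTop 0,
        ((tendsto_midSize_atTop hη).comp hφ').eventually_gt_atTop 0] with p hp hp'
      have : (φ p.1 : ℝ) ≠ 0 := by positivity
      have : (midSize η (φ p.1) : ℝ) ≠ 0 := by
        simp only [Function.comp_apply] at hp'
        positivity
      simp only [Function.comp_apply]
      push_cast
      field_simp
    refine (tendsto_pathDirection hη hw hφ' hu').inner (Tendsto.sub ?_ ?_)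
    · exact CadlagPath.tendsto_apply hw hu' ((continuous_unitTime.tendsto _).comp h2)
    · exact CadlagPath.tendsto_apply hw hu' ((continuous_unitTime.tendsto _).comp h1)
  · obtain ⟨C, hC⟩ := CadlagPath.exists_eventually_norm_le hw hu
    refine ⟨(C + C + C) * (C + C), hC.mono fun i hi k _ => ?_⟩
    have h1 : ‖pathDirection η (φ i) (u i)‖ ≤ C + C + C :=
      (norm_add_le _ _).trans (add_le_add ((norm_sub_le _ _).trans (add_le_add (hi _) (hi _)))
        (hi _))
    refine (abs_real_inner_le_norm _ _).trans (mul_le_mul h1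
      ((norm_sub_le _ _).trans (add_le_add (hi _) (hi _))) (norm_nonneg _) ?_)
    exact (norm_nonneg _).trans h1

end PathStatistic

section TestStatistic

variable {E : Type*} [NormedAddCommGroup H] [InnerProductSpace ℝ H] [CompleteSpace H]
  [RKHS ℝ H E ℝ] {η : ℝ}

lemma partialSumPath_unitTime (m : H) {n : ℕ} (hn : 0 < n) (y : ℤ → E) {j : ℕ} (hj : j ≤ n) :
    partialSumPath m n y (unitTime (j / n))
      = (√(n : ℝ))⁻¹ • ∑ i ∈ Finset.Icc 1 j, (feature H (y (i : ℤ)) - m) := by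
  have hn' : (0 : ℝ) < n := by exact_mod_cast hn
  have h : (unitTime (j / n) : ℝ) = j / n :=
    coe_unitTime ⟨by positivity, div_le_one_of_le₀ (by exact_mod_cast hj) hn'.le⟩
  have hfl : ⌊(n : ℝ) * (unitTime (j / n) : ℝ)⌋₊ = j := by
    rw [h, mul_div_cancel₀ _ hn'.ne', Nat.floor_natCast]
  change (√(n : ℝ))⁻¹ • ∑ i ∈ Finset.Icc 1 ⌊(n : ℝ) * (unitTime (j / n) : ℝ)⌋₊, _ = _
  rw [hfl]

lemma partialSumPath_one (m : H) {n : ℕ} (hn : 0 < n) (y : ℤ → E) :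
    partialSumPath m n y 1
      = (√(n : ℝ))⁻¹ • ∑ i ∈ Finset.Icc 1 n, (feature H (y (i : ℤ)) - m) := by
  have hn' : (n : ℝ) ≠ 0 := by positivity
  rw [← partialSumPath_unitTime m hn y le_rfl, div_self hn', unitTime_one]

/-- In the direction the mean embedding cancels because the two outer blocks have equal size; in the
projected observations it only adds a constant. What is left is the factor `m₁ / n`, which
`gridStat_affine` absorbs. -/
lemma testStatistic_eq_gridStat (hη : η ∈ Ioo (0 : ℝ) (1 / 2)) (m : H) {n : ℕ}
    (hn : 0 < splitSize η n) (y : ℤ → E) :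
    testStatistic H η n (fun i => y i)
      = gridStat (midSize η n) (pathIncrement η n (partialSumPath m n y)) := by
  have h2 := two_mul_splitSize_le hη n
  have hn0 : 0 < n := by omega
  have hn' : (0 : ℝ) < n := by exact_mod_cast hn0
  have hm' : (0 : ℝ) < splitSize η n := by exact_mod_cast hn
  have hdir : pathDirection η n (partialSumPath m n y)
      = ((√(n : ℝ))⁻¹ * splitSize η n) • direction H η n (fun i => y i) := by
    rw [pathDirection, partialSumPath_unitTime m hn0 y (by omega), partialSumPath_one m hn0,
      partialSumPath_unitTime m hn0 y (by omega), ← smul_sub, ← smul_add, mul_smul, direction]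
    congr 1
    have h1 := sum_Icc_eq_sub_of_le (fun i : ℕ => feature H (y i) - m)
      (Nat.sub_le n (splitSize η n))
    rw [sub_add, ← h1, smul_sub, smul_inv_smul₀ hm'.ne', smul_inv_smul₀ hm'.ne',
      Finset.sum_sub_distrib, Finset.sum_sub_distrib, Finset.sum_const, Finset.sum_const,
      Nat.card_Icc, Nat.card_Icc]
    have hc : n + 1 - (n - splitSize η n + 1) = splitSize η n + 1 - 1 := by omega
    rw [hc]
    abel
  refine (gridStat_affine (midSize η n) (a := (√(n : ℝ))⁻¹ * splitSize η n * (√(n : ℝ))⁻¹)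
    (by positivity) (-((√(n : ℝ))⁻¹ * splitSize η n * (√(n : ℝ))⁻¹ *
      ⟪direction H η n (fun i => y i), m⟫)) fun k hk => ?_).symm
  rw [Finset.mem_Icc, midSize] at hk
  have hinc : partialSumPath m n y (unitTime ((splitSize η n + k : ℕ) / n))
      - partialSumPath m n y (unitTime ((splitSize η n + (k - 1) : ℕ) / n))
      = (√(n : ℝ))⁻¹ • (feature H (y (splitSize η n + k : ℕ)) - m) := by
    rw [partialSumPath_unitTime m hn0 y (by omega), partialSumPath_unitTime m hn0 y (by omega),
      ← smul_sub, show splitSize η n + k = splitSize η n + (k - 1) + 1 by omega,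
      Finset.sum_Icc_succ_top (by omega), add_sub_cancel_left]
  rw [pathIncrement, hdir, hinc, inner_smul_left, inner_smul_right, inner_sub_right, projected]
  simp only [conj_trivial]
  ring

end TestStatistic

end Paths

/-! ### Reproducing kernel Hilbert spaces of continuous kernels -/

section ContinuousKernel

variable {E H : Type*} [TopologicalSpace E] [NormedAddCommGroup H] [InnerProductSpace ℝ H]
  [CompleteSpace H] [RKHS ℝ H E ℝ] {K : E → E → ℝ}

/-- By the reproducing property the squared distance of two features is `K x x - 2 * K x y + K y y`.
-/
lemma continuous_feature (hK : HasReproducingKernel H K) (hc : Continuous (Function.uncurry K)) :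
    Continuous (feature H : E → H) := by
  have hinner : ∀ x y : E, ⟪feature H x, feature H y⟫ = K x y := by
    intro x y
    rw [← hK x y, feature, feature, RKHS.inner_kerFun]
    simp
  have hnorm : ∀ x y : E, ‖feature H x - feature H y‖ = √(K x x - 2 * K x y + K y y) := by
    intro x y
    rw [← hinner, ← hinner, ← hinner, real_inner_self_eq_norm_sq, real_inner_self_eq_norm_sq,
      ← norm_sub_sq_real, Real.sqrt_sq (norm_nonneg _)]
  refine continuous_iff_continuousAt.2 fun y => tendsto_iff_norm_sub_tendsto_zero.2 ?_
  simp_rw [hnorm]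
  have h : Continuous fun x => √(K x x - 2 * K x y + K y y) := by
    have h1 : Continuous fun x => K x x := hc.comp (continuous_id.prodMk continuous_id)
    have h2 : Continuous fun x => K x y := hc.comp (continuous_id.prodMk continuous_const)
    fun_prop
  have := h.tendsto y
  rwa [show K y y - 2 * K y y + K y y = 0 by ring, Real.sqrt_zero] at this

/-- The features form a continuous image of a separable space, and their span is dense. Second
countability makes sums and inner products of random elements of `H` measurable. -/
lemma secondCountableTopology_of_continuous_kernel [TopologicalSpace.SeparableSpace E]
    (hK : HasReproducingKernel H K) (hc : Continuous (Function.uncurry K)) :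
    SecondCountableTopology H := by
  have hsep : TopologicalSpace.IsSeparable {x : H | ∃ (e : E) (v : ℝ), RKHS.kerFun H e v = x} := by
    have hcont : Continuous fun p : E × ℝ => p.2 • (feature H p.1 : H) :=
      continuous_snd.smul ((continuous_feature hK hc).comp continuous_fst)
    refine (TopologicalSpace.isSeparable_range hcont).mono ?_
    rintro _ ⟨e, v, rfl⟩
    refine ⟨(e, v), ?_⟩
    simp only [feature]
    rw [← map_smul, smul_eq_mul, mul_one]
  have huniv := hsep.span (R := ℝ) |>.closure
  rw [← Submodule.topologicalClosure_coe, RKHS.kerFun_dense, Submodule.top_coe] at huniv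
  have := TopologicalSpace.isSeparable_univ_iff.1 huniv
  exact UniformSpace.secondCountable_of_separable H

lemma aemeasurable_testStatistic {Ω : Type*} [MeasurableSpace Ω] {μ : Measure Ω}
    [MeasurableSpace E] [OpensMeasurableSpace E] [MeasurableSpace H] [BorelSpace H]
    [SecondCountableTopology H] (hf : Continuous (feature H : E → H)) {y : ℕ → Ω → E}
    (hy : ∀ i, AEMeasurable (y i) μ) (η : ℝ) (n : ℕ) :
    AEMeasurable (fun ω => testStatistic H η n fun i => y i ω) μ := by
  have hfy : ∀ i, AEMeasurable (fun ω => feature H (y i ω)) μ := fun i =>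
    hf.measurable.comp_aemeasurable (hy i)
  refine (measurable_gridStat (midSize η n)).comp_aemeasurable
    (aemeasurable_pi_lambda _ fun k => ?_)
  refine AEMeasurable.inner ?_ (hfy _)
  unfold direction
  fun_prop

end ContinuousKernel

/-! ### Fubini for laws of functions of independent variables -/

/-- Freezing: if the law of `F x Y` is `ρ` for almost every value `x` of `X`, Fubini on the product
law gives `ρ` again. This replaces conditioning on the projection direction. -/
lemma hasLaw_of_indepFun {Ω α β γ : Type*} [MeasurableSpace Ω] [MeasurableSpace α]
    [MeasurableSpace β] [MeasurableSpace γ] {P : Measure Ω} [IsProbabilityMeasure P]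
    {X : Ω → α} {Y : Ω → β} {F : α → β → γ} {ρ : Measure γ} (hX : AEMeasurable X P)
    (hY : AEMeasurable Y P) (h : IndepFun X Y P) (hF : Measurable (Function.uncurry F))
    (hlaw : ∀ᵐ ω ∂P, HasLaw (fun ω' => F (X ω) (Y ω')) ρ P) :
    HasLaw (fun ω => F (X ω) (Y ω)) ρ P := by
  have hXY : AEMeasurable (fun ω => (X ω, Y ω)) P := hX.prodMk hY
  refine ⟨hF.comp_aemeasurable hXY, Measure.ext fun A hA => ?_⟩
  have hmap : P.map (fun ω => F (X ω) (Y ω))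
      = ((P.map X).prod (P.map Y)).map (Function.uncurry F) := by
    rw [← h.map_prod_eq_prod_map_map hX hY,
      AEMeasurable.map_map_of_aemeasurable hF.aemeasurable hXY]
    rfl
  have := Measure.isProbabilityMeasure_map (μ := P) hY
  rw [hmap, Measure.map_apply hF hA, Measure.prod_apply (hF hA),
    lintegral_map' (measurable_measure_prodMk_left (hF hA)).aemeasurable hX]
  have hconst : ∀ᵐ ω ∂P, P.map Y (Prod.mk (X ω) ⁻¹' (Function.uncurry F ⁻¹' A)) = ρ A := by
    filter_upwards [hlaw] with ω hω
    have hsec : MeasurableSet (Prod.mk (X ω) ⁻¹' (Function.uncurry F ⁻¹' A)) :=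
      measurable_prodMk_left (hF hA)
    rw [Measure.map_apply_of_aemeasurable hY hsec, ← hω.map_eq,
      Measure.map_apply_of_aemeasurable hω.aemeasurable hA]
    rfl
  rw [lintegral_congr_ae hconst, lintegral_const, measure_univ, mul_one]

/-! ### Projected Hilbert space Brownian motion -/

section HilbertBrownian

variable {Ω H : Type*} [MeasurableSpace Ω] [NormedAddCommGroup H] [InnerProductSpace ℝ H]
  [MeasurableSpace H] {W : Ω → CadlagPath H} {S : H →L[ℝ] H} {ν : Measure Ω}

namespace IsHilbertBrownianMotion

lemma covariance_symm (hW : IsHilbertBrownianMotion W S ν) (x y : H) : ⟪S x, y⟫ = ⟪S y, x⟫ := by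
  have h1 := hW.covariance_increments 0 1 zero_le_one x y
  have h2 := hW.covariance_increments 0 1 zero_le_one y x
  simp only [Icc.coe_one, Icc.coe_zero, sub_zero, one_mul] at h1 h2
  rw [← h1, ← h2]
  simp_rw [mul_comm]

lemma covariance_nonneg (hW : IsHilbertBrownianMotion W S ν) (x : H) : 0 ≤ ⟪S x, x⟫ := by
  have h1 := hW.covariance_increments 0 1 zero_le_one x x
  simp only [Icc.coe_one, Icc.coe_zero, sub_zero, one_mul] at h1
  rw [← h1]
  exact integral_nonneg fun _ => mul_self_nonneg _

lemma eq_zero_of_covariance_eq_zero (hW : IsHilbertBrownianMotion W S ν) {x : H}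
    (hx : ⟪S x, x⟫ = 0) : S x = 0 := by
  -- This is the covariance form at `x + t • S x`. Its constant term vanishes, so nonnegativity for
  -- all `t` forces the linear coefficient to be zero.
  have hq : ∀ t : ℝ, 0 ≤ ⟪S (S x), S x⟫ * (t * t) + 2 * ⟪S x, S x⟫ * t + 0 := by
    intro t
    have h := hW.covariance_nonneg (x + t • S x)
    simp only [map_add, map_smul, inner_add_left, inner_add_right, inner_smul_left,
      inner_smul_right, conj_trivial, hx, hW.covariance_symm (S x) x] at h
    linarith
  have hd := discrim_le_zero hq
  rw [discrim] at hd
  have h0 : ⟪S x, S x⟫ = 0 := by nlinarith [sq_nonneg ⟪S x, S x⟫]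
  exact inner_self_eq_zero.1 h0

lemma covariance_pos (hW : IsHilbertBrownianMotion W S ν) {x : H} (hx : S x ≠ 0) :
    0 < ⟪S x, x⟫ :=
  (hW.covariance_nonneg x).lt_of_ne fun h => hx (hW.eq_zero_of_covariance_eq_zero h.symm)

/-- A direction `e` in the range of `S` such that only vectors orthogonal to `e` can be degenerate
for the covariance form. -/
lemma exists_covariance_pos (hW : IsHilbertBrownianMotion W S ν) (hS : S ≠ 0) :
    ∃ e : H, 0 < ⟪S e, e⟫ ∧ ∀ d : H, ⟪d, e⟫ ≠ 0 → 0 < ⟪S d, d⟫ := by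
  obtain ⟨x, hx⟩ : ∃ x, S x ≠ 0 := by
    by_contra! h
    exact hS (ContinuousLinearMap.ext h)
  -- Take `e = S x`. If `d` is degenerate then `S d = 0`, and symmetry gives `⟪d, S x⟫ = ⟪S d, x⟫ =
  -- 0`.
  refine ⟨S x, hW.covariance_pos fun h0 => hx ?_, fun d hd => hW.covariance_pos fun h0 => hd ?_⟩
  · have h1 := hW.covariance_symm (S x) x
    rw [h0, inner_zero_left] at h1
    exact inner_self_eq_zero.1 h1.symm
  · rw [real_inner_comm, hW.covariance_symm, h0, inner_zero_left]

lemma aemeasurable_increment (hW : IsHilbertBrownianMotion W S ν) {s t : unitInterval}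
    (hst : s ≤ t) : AEMeasurable (fun ω => W ω t - W ω s) ν :=
  (hW.gaussian_increments s t hst).aemeasurable

variable [BorelSpace H]

lemma hasLaw_inner_increment (hW : IsHilbertBrownianMotion W S ν) {s t : unitInterval}
    (hst : s ≤ t) (d : H) :
    HasLaw (fun ω => ⟪d, W ω t - W ω s⟫)
      (gaussianReal 0 (((t : ℝ) - s) * ⟪S d, d⟫).toNNReal) ν := by
  have hg : HasGaussianLaw (fun ω => ⟪d, W ω t - W ω s⟫) ν :=
    (hW.gaussian_increments s t hst).map_of_measurable (innerSL ℝ d)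
      (innerSL ℝ d).continuous.measurable
  have hm := hW.mean_increments s t hst d
  have hc := hW.covariance_increments s t hst d d
  simp_rw [real_inner_comm d] at hm hc
  refine ⟨hg.aemeasurable, ?_⟩
  rw [hg.map_eq_gaussianReal, variance_of_integral_eq_zero hg.aemeasurable hm, hm]
  simp_rw [sq]
  rw [hc, real_inner_comm (S d) d]

end IsHilbertBrownianMotion

/-- The time points `0, η, …, 1 - η, 1`, with an equidistant grid of `m + 1` intervals between `η`
and `1 - η`. -/
noncomputable def gridTime (η : ℝ) (m k : ℕ) : unitInterval :=
  if k = 0 then 0 else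
    if k ≤ m + 2 then unitTime (η + ((k - 1 : ℕ) : ℝ) / (m + 1 : ℕ) * (1 - 2 * η)) else 1

variable {η : ℝ}

lemma gridTime_zero (m : ℕ) : gridTime η m 0 = 0 := if_pos rfl

lemma gridTime_succ {m k : ℕ} (hk : k ≤ m + 1) :
    gridTime η m (k + 1) = unitTime (η + (k : ℝ) / (m + 1 : ℕ) * (1 - 2 * η)) := by
  rw [gridTime, if_neg (by omega), if_pos (by omega), Nat.add_sub_cancel]

lemma gridTime_one (m : ℕ) : gridTime η m 1 = unitTime η := by
  simpa using gridTime_succ (η := η) (m := m) (k := 0) (by omega)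

lemma gridTime_penultimate (m : ℕ) : gridTime η m (m + 2) = unitTime (1 - η) := by
  rw [gridTime_succ le_rfl, div_self (by positivity)]
  congr 1
  ring

lemma gridTime_last (m : ℕ) : gridTime η m (m + 3) = 1 := by
  rw [gridTime, if_neg (by omega), if_neg (by omega)]

lemma monotone_gridTime (hη : η ∈ Ioo (0 : ℝ) (1 / 2)) (m : ℕ) : Monotone (gridTime η m) := by
  refine monotone_nat_of_le_succ fun k => ?_
  rcases Nat.eq_zero_or_pos k with rfl | hk
  · rw [gridTime_zero]
    exact unitInterval.nonneg'
  · obtain ⟨j, rfl⟩ : ∃ j, k = j + 1 := ⟨k - 1, by omega⟩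
    by_cases hj : j + 1 ≤ m + 1
    · rw [gridTime_succ (by omega), gridTime_succ hj]
      refine unitTime_mono ?_
      have : 0 ≤ 1 - 2 * η := by linarith [hη.2]
      gcongr
      simp
    · rw [gridTime.eq_def η m (j + 1 + 1), if_neg (by omega), if_neg (by omega)]
      exact unitInterval.le_one'

lemma gridTime_sub (hη : η ∈ Ioo (0 : ℝ) (1 / 2)) {m k : ℕ} (hk : k ≤ m) :
    (gridTime η m (k + 2) : ℝ) - gridTime η m (k + 1) = (1 - 2 * η) / (m + 1 : ℕ) := by
  have hmem : ∀ j ≤ m + 1, η + (j : ℝ) / (m + 1 : ℕ) * (1 - 2 * η) ∈ Icc (0 : ℝ) 1 := by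
    intro j hj
    have h0 : 0 ≤ 1 - 2 * η := by linarith [hη.2]
    have h1 : (j : ℝ) / (m + 1 : ℕ) ≤ 1 :=
      div_le_one_of_le₀ (by exact_mod_cast hj) (by positivity)
    have h2 : (0 : ℝ) ≤ (j : ℝ) / (m + 1 : ℕ) := by positivity
    constructor
    · nlinarith [hη.1]
    · nlinarith [hη.1]
  rw [gridTime_succ (by omega : k + 1 ≤ m + 1), gridTime_succ (by omega : k ≤ m + 1),
    coe_unitTime (hmem _ (by omega)), coe_unitTime (hmem _ (by omega))]
  push_cast
  field_simp
  ring

namespace IsHilbertBrownianMotion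

/-- The projection direction, up to a null set, in terms of the outer increments. -/
lemma limitDirection_ae_eq (hW : IsHilbertBrownianMotion W S ν) (η : ℝ) :
    (fun ω => limitDirection η (W ω)) =ᵐ[ν]
      fun ω => (W ω (unitTime η) - W ω 0) - (W ω 1 - W ω (unitTime (1 - η))) := by
  filter_upwards [hW.start_zero] with ω hω
  rw [limitDirection, hω]
  abel

variable [BorelSpace H]

/-- It suffices that the direction is almost surely not orthogonal to one fixed `e`. Its inner
product with `e` is a difference of two independent Gaussians, the first with variance `η ⟪S e, e⟫ >
0`. -/
lemma ae_covariance_limitDirection_pos (hW : IsHilbertBrownianMotion W S ν) (hS : S ≠ 0)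
    (hη : η ∈ Ioo (0 : ℝ) (1 / 2)) :
    ∀ᵐ ω ∂ν, 0 < ⟪S (limitDirection η (W ω)), limitDirection η (W ω)⟫ := by
  obtain ⟨e, he, hpos⟩ := hW.exists_covariance_pos hS
  -- For `m = 0` the grid is `0, η, 1 - η, 1`; the increments `0` and `2` are the outer ones.
  have hind := (hW.indep_increments.nat (monotone_gridTime hη 0)).indepFun (by decide : 0 ≠ 2)
  have h0 : (0 : unitInterval) ≤ unitTime η := unitInterval.nonneg'
  have h1 : unitTime (1 - η) ≤ 1 := unitInterval.le_one'
  have e1 := gridTime_one (η := η) 0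
  have e2 := gridTime_penultimate (η := η) 0
  have e3 := gridTime_last (η := η) 0
  simp only [zero_add, Nat.reduceAdd] at e1 e2 e3 hind
  rw [gridTime_zero, e1, e2, e3] at hind
  have hme : Measurable fun v : H => ⟪e, v⟫ := (innerSL ℝ e).continuous.measurable
  have hne := ae_ne_of_indepFun_gaussianReal (hW.hasLaw_inner_increment h0 e)
    (hW.hasLaw_inner_increment h1 e) ?_ (hind.comp hme hme)
  · filter_upwards [hne, hW.limitDirection_ae_eq η] with ω hω heq
    refine hpos _ ?_
    rw [heq, real_inner_comm, inner_sub_right]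
    exact sub_ne_zero.2 hω
  · rw [coe_unitTime ⟨hη.1.le, by linarith [hη.2]⟩]
    have := hη.1
    simp only [Icc.coe_zero, sub_zero, ne_eq, Real.toNNReal_eq_zero, not_le]
    positivity

variable [SecondCountableTopology H]

/-- The direction uses only the increments `0` and `m + 2`, the projections only `1, …, m + 1`. With
the direction frozen at `d`, these projections are independent centred Gaussians of variance `(1 -
2η) ⟪S d, d⟫ / (m + 1)`. -/
lemma hasLaw_projected_increments [IsProbabilityMeasure ν] (hW : IsHilbertBrownianMotion W S ν)
    (hS : S ≠ 0) (hη : η ∈ Ioo (0 : ℝ) (1 / 2)) (m : ℕ) :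
    HasLaw (fun ω (k : Fin (m + 1)) => ⟪limitDirection η (W ω),
        W ω (gridTime η m (k + 2)) - W ω (gridTime η m (k + 1))⟫
          / √((1 - 2 * η) * ⟪S (limitDirection η (W ω)), limitDirection η (W ω)⟫))
      (Measure.pi fun _ => gaussianReal 0 ((m + 1 : ℕ) : ℝ≥0)⁻¹) ν := by
  have hmono := monotone_gridTime hη m
  have hind := hW.indep_increments.nat hmono
  set J : ℕ → Ω → H := fun i ω => W ω (gridTime η m (i + 1)) - W ω (gridTime η m i) with hJ
  have hJm : ∀ i, AEMeasurable (J i) ν := fun i =>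
    hW.aemeasurable_increment (hmono (Nat.le_succ i))
  set D : Ω → H := fun ω => J 0 ω - J (m + 2) ω with hD
  have hDeq : (fun ω => limitDirection η (W ω)) =ᵐ[ν] D := by
    refine (hW.limitDirection_ae_eq η).trans (.of_eq ?_)
    simp only [hD, hJ, zero_add, gridTime_zero, gridTime_one, gridTime_penultimate]
    rw [gridTime_last]
  set V : Ω → Fin (m + 1) → H := fun ω k => J (k + 1) ω with hV
  have hDV : IndepFun D V ν := by
    have hdisj : Disjoint ({0, m + 2} : Finset ℕ) (Finset.Icc 1 (m + 1)) := by
      rw [Finset.disjoint_left]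
      intro i hi hi'
      simp only [Finset.mem_insert, Finset.mem_singleton, Finset.mem_Icc] at hi hi'
      omega
    have h := hind.indepFun_finset₀ _ _ hdisj hJm
    have hφ : Measurable fun v : ({0, m + 2} : Finset ℕ) → H =>
        v ⟨0, by simp⟩ - v ⟨m + 2, by simp⟩ :=
      (measurable_pi_apply _).sub (measurable_pi_apply _)
    have hψ : Measurable fun (v : Finset.Icc 1 (m + 1) → H) (k : Fin (m + 1)) =>
        v ⟨k + 1, by rw [Finset.mem_Icc]; omega⟩ :=
      measurable_pi_lambda _ fun k => measurable_pi_apply _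
    exact h.comp hφ hψ
  have hlaw := hasLaw_of_indepFun (P := ν) (X := D) (Y := V)
    (F := fun d v k => ⟪d, v k⟫ / √((1 - 2 * η) * ⟪S d, d⟫))
    (ρ := Measure.pi fun _ => gaussianReal 0 ((m + 1 : ℕ) : ℝ≥0)⁻¹)
    ((hJm 0).sub (hJm (m + 2))) (aemeasurable_pi_lambda _ fun k => hJm _) hDV ?_ ?_
  · refine hlaw.congr ?_
    filter_upwards [hDeq] with ω hω
    rw [← hω]
  · refine measurable_pi_lambda _ fun k => ?_
    have h1 : Measurable fun p : H × (Fin (m + 1) → H) => ⟪p.1, p.2 k⟫ := by fun_prop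
    have h2 : Measurable fun p : H × (Fin (m + 1) → H) => ⟪S p.1, p.1⟫ := by fun_prop
    exact h1.div (h2.const_mul _).sqrt
  · filter_upwards [hW.ae_covariance_limitDirection_pos hS hη, hDeq] with ω hpos heq
    rw [heq] at hpos
    generalize D ω = d at hpos
    have hσ : 0 < (1 - 2 * η) * ⟪S d, d⟫ := mul_pos (by linarith [hη.2]) hpos
    refine iIndepFun.hasLaw_pi (fun k => ?_) ?_
    · have h1 := gaussianReal_div_const (hW.hasLaw_inner_increment
        (hmono (Nat.le_succ ((k : ℕ) + 1))) d) (√((1 - 2 * η) * ⟪S d, d⟫))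
      rw [gridTime_sub hη (by omega), zero_div] at h1
      convert h1 using 2
      rw [← NNReal.coe_inj]
      have hm : (0 : ℝ) < (m + 1 : ℕ) := by positivity
      rw [NNReal.coe_div, Real.coe_toNNReal _ (by
        rw [div_mul_eq_mul_div]; exact (div_pos hσ hm).le)]
      rw [NNReal.coe_mk, Real.sq_sqrt hσ.le, div_mul_eq_mul_div, div_div, mul_comm ((m + 1 : ℕ) : ℝ),
        ← div_div, div_self hσ.ne', NNReal.coe_inv, one_div, NNReal.coe_natCast]
    · have hinj : Function.Injective fun k : Fin (m + 1) => (k : ℕ) + 1 := fun i j hij => by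
        simpa [Fin.ext_iff] using hij
      refine (hind.precomp hinj).comp (fun _ v => ⟪d, v⟫ / √((1 - 2 * η) * ⟪S d, d⟫)) fun _ => ?_
      fun_prop

/-- The projected path of a Hilbert space Brownian motion is a Brownian motion, up to a random
scale. -/
lemma hasBrownianGridLaw [IsProbabilityMeasure ν] (hW : IsHilbertBrownianMotion W S ν)
    (hS : S ≠ 0) (hη : η ∈ Ioo (0 : ℝ) (1 / 2)) :
    HasBrownianGridLaw (fun t ω => projectedPath η (W ω) t)
      (fun ω => √((1 - 2 * η) * ⟪S (limitDirection η (W ω)), limitDirection η (W ω)⟫)) ν where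
  start_zero := .of_forall fun ω => by simp [projectedPath]
  scale_pos := by
    filter_upwards [hW.ae_covariance_limitDirection_pos hS hη] with ω hω
    exact Real.sqrt_pos.2 (mul_pos (by linarith [hη.2]) hω)
  continuousOn := by
    filter_upwards [hW.continuous_paths] with ω hω
    have h := continuous_unitTime
    have : Continuous fun t : ℝ => W ω (unitTime (η + t * (1 - 2 * η))) := hω.comp (by fun_prop)
    unfold projectedPath
    fun_prop
  law m := by
    refine (hW.hasLaw_projected_increments hS hη m).congr (.of_forall fun ω => funext fun k => ?_)
    simp only [projectedPath]
    rw [← inner_sub_right, sub_sub_sub_cancel_right,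
      gridTime_succ (by omega), gridTime_succ (by omega)]

end IsHilbertBrownianMotion

end HilbertBrownian

end KernelCPD

/-! ### The limit theorem for the test statistic -/

theorem theorem3p3 {p : ℕ} {H Ω Ω' Ω'' : Type*}
    -- the continuous kernel `K` on `ℝ^p` and its reproducing kernel Hilbert space `H = ℋ(K)`
    (K : EuclideanSpace ℝ (Fin p) → EuclideanSpace ℝ (Fin p) → ℝ)
    (hKcont : Continuous (Function.uncurry K))
    [NormedAddCommGroup H] [InnerProductSpace ℝ H] [CompleteSpace H]
    [MeasurableSpace H] [BorelSpace H] [RKHS ℝ H (EuclideanSpace ℝ (Fin p)) ℝ]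
    (hK : KernelCPD.HasReproducingKernel H K)
    -- the time series; under the null hypothesis all `Y i` have the same law `P`
    [MeasurableSpace Ω] (μ : Measure Ω) [IsProbabilityMeasure μ]
    (Y : ℤ → Ω → EuclideanSpace ℝ (Fin p))
    (P : Measure (EuclideanSpace ℝ (Fin p)))
    (hnull : ∀ i, HasLaw (Y i) P μ)
    (μP : H) (hμP : KernelCPD.IsMeanEmbedding P μP)
    -- the functional central limit theorem, with a nonzero long-run covariance operator
    [MeasurableSpace Ω'] (ν : Measure Ω') [IsProbabilityMeasure ν]
    (W : Ω' → KernelCPD.CadlagPath H) (S : H →L[ℝ] H)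
    (hFCLT : KernelCPD.SatisfiesFCLT Y μP W S μ ν) (hS : S ≠ 0)
    -- the splitting ratio
    (η : ℝ) (hη : η ∈ Ioo (0 : ℝ) (1 / 2))
    -- a standard Brownian motion
    [MeasurableSpace Ω''] (ν' : Measure Ω'') [IsProbabilityMeasure ν']
    (B : ℝ≥0 → Ω'' → ℝ) (hB : IsBrownianReal B ν') :
    TendstoInDistribution
      (fun (n : ℕ) ω => KernelCPD.testStatistic H η n (fun i => Y i ω)) atTop
      (fun ω => KernelCPD.limitFunctional (fun t => B t.toNNReal ω)) (fun _ => μ) ν' := by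
  have hcont := KernelCPD.continuous_feature hK hKcont
  have := KernelCPD.secondCountableTopology_of_continuous_kernel hK hKcont
  have hU := hFCLT.brownian.hasBrownianGridLaw hS hη
  have hUlim := hU.tendstoInDistribution
  have hBlim := (KernelCPD.hasBrownianGridLaw_of_isBrownianReal hB).tendstoInDistribution
  have hmain : TendstoInDistribution
      (fun (n : ℕ) ω => KernelCPD.testStatistic H η n (fun i => Y i ω)) atTop
      (fun ω => KernelCPD.limitFunctional (KernelCPD.projectedPath η (W ω))) (fun _ => μ) ν := by
    refine hFCLT.weak_convergence.extended_mapping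
      (g := fun n w => KernelCPD.gridStat (KernelCPD.midSize η n) (KernelCPD.pathIncrement η n w))
      (KernelCPD.aemeasurable_testStatistic hcont (fun i => (hnull i).aemeasurable) η)
      hUlim.aemeasurable_limit ?_ ?_
    · filter_upwards [(KernelCPD.tendsto_splitSize_atTop hη.1).eventually_gt_atTop 0] with n hn ω
      exact KernelCPD.testStatistic_eq_gridStat hη μP hn fun i => Y i ω
    · filter_upwards [hFCLT.brownian.continuous_paths, hU.ae_limitNormalizer_pos]
        with ω hω hpos φ u hφ hu
      exact (KernelCPD.gridTendsto_pathIncrement hη hω hφ hu).tendsto_gridStat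
        ((KernelCPD.tendsto_midSize_atTop hη).comp hφ) hpos
  refine ⟨hmain.forall_aemeasurable, hBlim.aemeasurable_limit, ?_⟩
  -- The functionals of the projected path and of `B` are limits of the same Gaussian grid
  -- statistics, so their laws agree and one may replace the other as the limit.
  have hlaw := tendstoInDistribution_unique _ hUlim hBlim
  convert hmain.tendsto using 2
  refine congrArg 𝓝 (Subtype.ext ?_)
  exact hlaw.symm
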